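/- Let $\Bbbk$ be a field of characteristic zero and let $C^*([0,1])=C^0\oplus C^1\subset \Bbbk[t]\oplus\Bbbk[t]\,dt$ be the complex of Whitney forms, $C^0=\{at+b(1-t)\mid a,b\in\Bbbk\}$, $C^1=\{c\,dt\mid c\in\Bbbk\}$, with the de Rham differential $d$. Write $\mathbf{s}$ for the suspension, $(\mathbf{s}V)^i=V^{i+1}$, and equip the reduced tensor coalgebra $\overline{T}(\mathbf{s}C^*([0,1]))=\bigoplus_{n\ge1}(\mathbf{s}C^*([0,1]))^{\otimes n}$ with the deconcatenation coproduct and the graded shuffle product. Let $C^*_\infty([0,1])$ be the unital $C_\infty$ algebra given by the coderivation $M$ of $\overline{T}(\mathbf{s}C^*([0,1]))$ of degree one whose Taylor coefficients $m_n:(\mathbf{s}C^*([0,1]))^{\otimes n}\to\mathbf{s}C^*([0,1])$ are as follows: - $m_1(\mathbf{s}x)=-\mathbf{s}\,dx$; - $m_2(\mathbf{s}1\otimes\mathbf{s}x)=\mathbf{s}x$, $m_2(\mathbf{s}x\otimes\mathbf{s}1)=(-1)^{|x|}\mathbf{s}x$, and $m_n$ vanishes for $n\ge3$ whenever one argument is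 $\mathbf{s}1$; - $m_2(\mathbf{s}t\otimes\mathbf{s}t)=\mathbf{s}t$; - $m_{n+1}\big((\mathbf{s}dt)^{\otimes i}\otimes\mathbf{s}t\otimes(\mathbf{s}dt)^{\otimes n-i}\big)=(-1)^{i+1}\binom{n}{i}\frac{B_n}{n!}\,\mathbf{s}dt$ for $n\ge1$, $0\le i\le n$, where $\sum_{n\ge0}B_n\frac{z^n}{n!}=\frac{z}{e^z-1}$; - $m_n$, $n\ge2$, vanishes on all other tensor products of the elements $\mathbf{s}1,\mathbf{s}t,\mathbf{s}dt$. A unital $C_\infty$ endomorphism of $C^*_\infty([0,1])$ is a linear map $\psi$ of degree zero from $\overline{T}(\mathbf{s}C^*([0,1]))$ to itself that is compatible with the coproduct, with the shuffle product and with $M$, and whose Taylor coefficients $\psi_n:(\mathbf{s}C^*([0,1]))^{\otimes n}\to\mathbf{s}C^*([0,1])$ satisfy $\psi_1(\mathbf{s}1)=\mathbf{s}1$ and $\psi_n(\cdots\otimes\mathbf{s}1\otimes\cdots)=0$ for $n\ge2$. Let $\mathsf{Aut}_\infty(C^*_\infty([0,1]))$ be the group of invertible elements of the monoid of these endomorphisms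 under composition, and let $\mathrm{GL}(C^*([0,1]))$ be the group of those automorphisms of the complex $C^*([0,1])$ that map $1$ to itself. Then $\psi\mapsto\psi_1$ (regarded as a map from $C^*([0,1])$ to itself) is a well-defined isomorphism of groups $$r:\mathsf{Aut}_\infty(C^*_\infty([0,1]))\to\mathrm{GL}(C^*([0,1])).$$ Moreover $\mathrm{GL}(C^*([0,1]))\cong\mathsf{Aff}(\Bbbk)\cong\Bbbk^*\ltimes\Bbbk$, where $\mathsf{Aff}(\Bbbk)$ is the group of affine bijections of $\Bbbk$: there is an isomorphism of groups sending $\xi\in\mathrm{GL}(C^*([0,1]))$ to an affine bijection $A_\xi$ with $\xi(f)=f\circ A_\xi^{-1}$ for all $f\in C^0$, and an isomorphism of groups sending the affine bijection $x\mapsto\alpha x+\beta$ to $(\alpha,\beta)\in\Bbbk^*\ltimes\Bbbk$, where $\Bbbk^*$ acts on $\Bbbk$ by multiplication. -/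

import Mathlib

open Polynomial
open scoped TensorProduct

noncomputable section

/-! ### Polynomial differential forms on the interval and Whitney forms -/

namespace Whitney

/-- Polynomial differential forms on `[0,1]`: the pair `(f, a)` is the form `f + a dt`. -/
abbrev PolyForm (k : Type*) [Field k] : Type _ := k[X] × k[X]

/-- The de Rham differential `f + a dt ↦ f' dt`. -/
def polyD (k : Type*) [Field k] : PolyForm k →ₗ[k] PolyForm k :=
  (LinearMap.inr k k[X] k[X]).comp (Polynomial.derivative.comp (LinearMap.fst k k[X] k[X]))

/-- The Whitney forms `{a t + b (1 - t)} ⊕ {c dt}` inside the polynomial forms. -/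
def forms (k : Type*) [Field k] : Submodule k (PolyForm k) :=
  (Submodule.span k {(X : k[X]), 1 - X}).prod (Submodule.span k {(1 : k[X])})

/-- Whitney forms of degree zero. -/
def forms0 (k : Type*) [Field k] : Submodule k (forms k) :=
  LinearMap.ker ((LinearMap.snd k k[X] k[X]).comp (forms k).subtype)

/-- Whitney forms of degree one. -/
def forms1 (k : Type*) [Field k] : Submodule k (forms k) :=
  LinearMap.ker ((LinearMap.fst k k[X] k[X]).comp (forms k).subtype)

lemma polyD_mem {k : Type*} [Field k] (x : PolyForm k) (hx : x ∈ forms k) :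
    polyD k x ∈ forms k := by
  obtain ⟨h1, -⟩ := Submodule.mem_prod.1 hx
  obtain ⟨a, b, hab⟩ := Submodule.mem_span_pair.1 h1
  refine Submodule.mem_prod.2 ⟨Submodule.zero_mem _, ?_⟩
  refine Submodule.mem_span_singleton.2 ⟨a - b, ?_⟩
  simp [polyD, ← hab, sub_eq_add_neg, add_smul]

/-- The differential of the complex of Whitney forms. -/
def d (k : Type*) [Field k] : forms k →ₗ[k] forms k :=
  (polyD k).restrict polyD_mem

/-- Labels of the homogeneous basis `1, t, dt` of the Whitney forms. -/
inductive Letter : Type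
  | one
  | t
  | dt
  deriving DecidableEq

/-- The polynomial form named by a letter. -/
def letterForm (k : Type*) [Field k] : Letter → PolyForm k
  | .one => (1, 0)
  | .t => (X, 0)
  | .dt => (0, 1)

lemma letterForm_mem (k : Type*) [Field k] (j : Letter) : letterForm k j ∈ forms k := by
  cases j
  · exact Submodule.mem_prod.2
      ⟨Submodule.mem_span_pair.2 ⟨1, 1, by simp [letterForm]⟩, Submodule.zero_mem _⟩
  · exact Submodule.mem_prod.2
      ⟨Submodule.mem_span_pair.2 ⟨1, 0, by simp [letterForm]⟩, Submodule.zero_mem _⟩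
  · exact Submodule.mem_prod.2
      ⟨Submodule.zero_mem _, Submodule.mem_span_singleton.2 ⟨1, by simp [letterForm]⟩⟩

/-- The elements `1, t, dt` of the space of Whitney forms. -/
def letter (k : Type*) [Field k] (j : Letter) : forms k := ⟨letterForm k j, letterForm_mem k j⟩

instance : Fintype Letter := ⟨{.one, .t, .dt}, fun j => by cases j <;> simp⟩

lemma sum_letter {M : Type*} [AddCommMonoid M] (f : Letter → M) :
    ∑ j, f j = f .one + (f .t + f .dt) := by
  change ∑ j ∈ {Letter.one, Letter.t, Letter.dt}, f j = _
  simp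

lemma letter_linearIndependent (k : Type*) [Field k] : LinearIndependent k (letter k) := by
  rw [Fintype.linearIndependent_iff]
  intro g hg
  rw [sum_letter] at hg
  have h := congrArg Subtype.val hg
  simp only [letter, letterForm, Submodule.coe_add, Submodule.coe_smul, Submodule.coe_zero] at h
  have h1 := congrArg Prod.fst h
  have h2 := congrArg Prod.snd h
  have a0 := congrArg (fun p : k[X] => p.coeff 0) h1
  have a1 := congrArg (fun p : k[X] => p.coeff 1) h1
  have a2 := congrArg (fun p : k[X] => p.coeff 0) h2
  simp [coeff_one] at a0 a1 a2
  intro j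
  cases j
  · exact a0
  · exact a1
  · exact a2

lemma letter_span (k : Type*) [Field k] : ⊤ ≤ Submodule.span k (Set.range (letter k)) := by
  rintro ⟨⟨f, a⟩, hx⟩ -
  obtain ⟨h1, h2⟩ := Submodule.mem_prod.1 hx
  obtain ⟨p, q, hpq⟩ := Submodule.mem_span_pair.1 h1
  obtain ⟨c, hc⟩ := Submodule.mem_span_singleton.1 h2
  have key : (⟨(f, a), hx⟩ : forms k)
      = q • letter k .one + (p - q) • letter k .t + c • letter k .dt := by
    apply Subtype.ext
    simp only at hpq hc
    simp only [letter, letterForm, Submodule.coe_add, Submodule.coe_smul, Prod.smul_mk,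
      Prod.mk_add_mk, smul_zero, add_zero, zero_add, ← hpq, hc, Prod.mk.injEq, and_true]
    rw [smul_sub, sub_smul]
    abel
  rw [key]
  have hm (j : Letter) : letter k j ∈ Submodule.span k (Set.range (letter k)) :=
    Submodule.subset_span ⟨j, rfl⟩
  exact Submodule.add_mem _ (Submodule.add_mem _ (Submodule.smul_mem _ _ (hm _))
    (Submodule.smul_mem _ _ (hm _))) (Submodule.smul_mem _ _ (hm _))

/-- The homogeneous basis `1, t, dt` of the space of Whitney forms. -/
def basis (k : Type*) [Field k] : Module.Basis Letter k (forms k) :=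
  Module.Basis.mk (letter_linearIndependent k) (letter_span k)

/-- The monoid of endomorphisms of the cochain complex of Whitney forms that fix `1`. -/
def chainEnd (k : Type*) [Field k] : Submonoid (Module.End k (forms k)) where
  carrier := {ξ | (∀ x ∈ forms0 k, ξ x ∈ forms0 k) ∧ (∀ x ∈ forms1 k, ξ x ∈ forms1 k) ∧
    (∀ x, d k (ξ x) = ξ (d k x)) ∧ ξ (letter k .one) = letter k .one}
  one_mem' := ⟨fun _ h => h, fun _ h => h, fun _ => rfl, rfl⟩
  mul_mem' := by
    rintro ξ η ⟨a1, a2, a3, a4⟩ ⟨b1, b2, b3, b4⟩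
    refine ⟨fun x hx => a1 _ (b1 x hx), fun x hx => a2 _ (b2 x hx), fun x => ?_, ?_⟩
    · simp only [Module.End.mul_apply, a3, b3]
    · simp only [Module.End.mul_apply, a4, b4]

/-- The group of automorphisms of the complex of Whitney forms that map `1` to itself. -/
abbrev ChainAut (k : Type*) [Field k] : Type _ := (chainEnd k)ˣ

end Whitney

/-! ### The reduced tensor coalgebra on a graded vector space with homogeneous basis `ι`

Throughout, `V = ι →₀ k` is the graded vector space with basis `ι`, and `deg : ι → ℤ` gives the
degrees of the basis elements (in applications `V` is the suspension of the space of interest, and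
`deg` is the degree after suspension). -/

namespace TBar

/-- The reduced tensor coalgebra `⨁ n ≥ 1, V ⊗ ⋯ ⊗ V`, with its basis of nonempty words
`x₁ ⊗ ⋯ ⊗ xₙ` in the basis elements of `V`. -/
abbrev T (k ι : Type*) [Field k] : Type _ := {w : List ι // w ≠ []} →₀ k

/-- The basis element of the reduced tensor coalgebra given by a word, and zero for the empty
word. -/
def word (k : Type*) [Field k] {ι : Type*} (w : List ι) : T k ι := by
  classical exact if h : w ≠ [] then Finsupp.single ⟨w, h⟩ 1 else 0

/-- The total degree of a word. -/
def wdeg {ι : Type*} (deg : ι → ℤ) (w : List ι) : ℤ := (w.map deg).sum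

/-- The Koszul sign `(-1)^n`. -/
def sgn (k : Type*) [Field k] (n : ℤ) : k := ((Int.negOnePow n : ℤˣ) : ℤ)

/-- The linear map with prescribed values on the basis of words. -/
def lift {k ι M : Type*} [Field k] [AddCommGroup M] [Module k M] (f : List ι → M) :
    T k ι →ₗ[k] M :=
  Finsupp.linearCombination k (fun w : {w : List ι // w ≠ []} => f w.1)

/-- The deconcatenation coproduct `x₁ ⊗ ⋯ ⊗ xₙ ↦ ∑_{0 < i < n} (x₁ ⊗ ⋯ ⊗ xᵢ) ⊗ (xᵢ₊₁ ⊗ ⋯ ⊗ xₙ)`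
(the term with `i = 0` in the sum vanishes, since `word k [] = 0`). -/
def comul (k ι : Type*) [Field k] : T k ι →ₗ[k] T k ι ⊗[k] T k ι :=
  lift (fun w => ∑ i ∈ Finset.range w.length, word k (w.take i) ⊗ₜ[k] word k (w.drop i))

/-- The projection onto the tensors of length one, `V` itself. -/
def proj (k ι : Type*) [Field k] : T k ι →ₗ[k] (ι →₀ k) :=
  lift (fun w => match w with
    | [j] => Finsupp.single j 1
    | _ => 0)

/-- The inclusion of `V` as the tensors of length one. -/
def incl (k ι : Type*) [Field k] : (ι →₀ k) →ₗ[k] T k ι :=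
  Finsupp.linearCombination k (fun j => word k [j])

/-- Left tensoring with a basis element. -/
def cons (k : Type*) [Field k] {ι : Type*} (j : ι) : T k ι →ₗ[k] T k ι :=
  lift (fun w => word k (j :: w))

/-- The signed sum of all shuffles of two words. -/
def shuffleWord (k : Type*) [Field k] {ι : Type*} (deg : ι → ℤ) : List ι → List ι → T k ι
  | [], v => word k v
  | u, [] => word k u
  | a :: u, b :: v =>
      cons k a (shuffleWord k deg u (b :: v)) +
        sgn k (deg b * wdeg deg (a :: u)) • cons k b (shuffleWord k deg (a :: u) v)
  termination_by u v => u.length + v.length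

/-- The graded shuffle product on the reduced tensor coalgebra. -/
def shuffle (k : Type*) [Field k] {ι : Type*} (deg : ι → ℤ) : T k ι →ₗ[k] T k ι →ₗ[k] T k ι :=
  lift (fun u => lift (fun v => shuffleWord k deg u v))

/-- The coderivation of degree one of the reduced tensor coalgebra with Taylor coefficients `m`
(given on words in the basis elements):
`Q (x₁ ⊗ ⋯ ⊗ xₙ) = ∑ ± x₁ ⊗ ⋯ ⊗ xᵢ ⊗ m (xᵢ₊₁ ⊗ ⋯ ⊗ xᵢ₊ₗ) ⊗ xᵢ₊ₗ₊₁ ⊗ ⋯ ⊗ xₙ`, the sum being over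
`0 ≤ i`, `1 ≤ l`, `i + l ≤ n`, with sign `(-1)^(|x₁| + ⋯ + |xᵢ|)`. -/
def coder {k ι : Type*} [Field k] (deg : ι → ℤ) (m : List ι → (ι →₀ k)) : T k ι →ₗ[k] T k ι :=
  lift (fun w => ∑ i ∈ Finset.range w.length, ∑ l ∈ Finset.Icc 1 (w.length - i),
    sgn k (wdeg deg (w.take i)) •
      (m ((w.drop i).take l)).sum
        (fun j c => c • word k (w.take i ++ j :: w.drop (i + l))))

/-- A linear endomorphism of the reduced tensor coalgebra is a unital `C∞` morphism (from the
structure with Taylor coefficients `m` and unit the basis element `e` to itself) if it has degree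
zero, is a morphism of dg bialgebras for the deconcatenation coproduct, the shuffle product and the
codifferential, and satisfies `F₁ e = e` and `Fₙ (⋯ ⊗ e ⊗ ⋯) = 0` for `n ≥ 2`. -/
structure IsUnitalCInf {k ι : Type*} [Field k] (deg : ι → ℤ) (m : List ι → (ι →₀ k)) (e : ι)
    (F : Module.End k (T k ι)) : Prop where
  degree : ∀ w v : {w : List ι // w ≠ []}, F (word k w.1) v ≠ 0 → wdeg deg v.1 = wdeg deg w.1
  comul : ∀ x, TBar.comul k ι (F x) = TensorProduct.map F F (TBar.comul k ι x)
  shuffle : ∀ x y, F (TBar.shuffle k deg x y) = TBar.shuffle k deg (F x) (F y)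
  coder : ∀ x, F (TBar.coder deg m x) = TBar.coder deg m (F x)
  unit_one : proj k ι (F (word k [e])) = Finsupp.single e 1
  unit_zero : ∀ w : List ι, 2 ≤ w.length → e ∈ w → proj k ι (F (word k w)) = 0

section lemmas

variable {k ι : Type*} [Field k]

lemma word_eq (w : {w : List ι // w ≠ []}) : word k w.1 = Finsupp.single w 1 := by
  simp [word, w.2]

lemma lift_word {M : Type*} [AddCommGroup M] [Module k M] (f : List ι → M) {w : List ι}
    (hw : w ≠ []) : lift (k := k) f (word k w) = f w := by
  rw [word_eq ⟨w, hw⟩]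
  simp [lift]

lemma hom_ext {M : Type*} [AddCommGroup M] [Module k M] {f g : T k ι →ₗ[k] M}
    (h : ∀ w : List ι, w ≠ [] → f (word k w) = g (word k w)) : f = g := by
  refine Finsupp.lhom_ext' fun w => LinearMap.ext_ring ?_
  have := h w.1 w.2
  rwa [word_eq] at this

lemma eq_sum (x : T k ι) : x = x.sum fun w c => c • word k w.1 := by
  conv_lhs => rw [← Finsupp.sum_single x]
  exact Finsupp.sum_congr fun w _ => by rw [word_eq]; simp

/-- The coefficient of a word. -/
def coeff (k : Type*) [Field k] {ι : Type*} (w : {w : List ι // w ≠ []}) : T k ι →ₗ[k] k :=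
  Finsupp.lapply w

lemma coeff_word [DecidableEq ι] (w : {w : List ι // w ≠ []}) (v : List ι) :
    coeff k w (word k v) = if v = w.1 then 1 else 0 := by
  by_cases hv : v = []
  · subst hv
    simp [word, coeff, w.2.symm]
  · rw [word_eq ⟨v, hv⟩]
    simp [coeff, Finsupp.single_apply, Subtype.ext_iff]

lemma proj_apply (x : T k ι) (j : ι) : proj k ι x j = x ⟨[j], by simp⟩ := by
  classical
  have : (Finsupp.lapply j).comp (proj k ι) = coeff k (⟨[j], by simp⟩ : {w : List ι // w ≠ []}) := by
    refine hom_ext fun w hw => ?_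
    rw [coeff_word, LinearMap.comp_apply, proj, lift_word _ hw]
    rcases w with _ | ⟨a, _ | ⟨b, w⟩⟩
    · exact absurd rfl hw
    · simp [Finsupp.single_apply]
    · simp
  exact LinearMap.congr_fun this x

/-- The coefficient of `j ⊗ v` in `x` is the coefficient of `[j] ⊗ v` in the coproduct of `x`. -/
lemma coeff_comul (j : ι) (v : {w : List ι // w ≠ []}) (x : T k ι) :
    LinearMap.mul' k k (TensorProduct.map (coeff k ⟨[j], by simp⟩) (coeff k v) (comul k ι x))
      = x ⟨j :: v.1, by simp⟩ := by
  classical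
  have : (LinearMap.mul' k k).comp ((TensorProduct.map (coeff k ⟨[j], by simp⟩) (coeff k v)).comp
      (comul k ι)) = coeff k (⟨j :: v.1, by simp⟩ : {w : List ι // w ≠ []}) := by
    refine hom_ext fun w hw => ?_
    simp only [LinearMap.comp_apply, comul, lift_word _ hw, map_sum, TensorProduct.map_tmul,
      LinearMap.mul'_apply, coeff_word]
    by_cases h : w = j :: v.1
    · rw [Finset.sum_eq_single 1]
      · simp [h]
      · intro i _ hi
        rw [if_neg, zero_mul]
        intro hc
        have := congrArg List.length hc
        have hv := List.length_pos_of_ne_nil v.2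
        simp [h] at this
        omega
      · intro hc
        have hv := List.length_pos_of_ne_nil v.2
        simp [h] at hc
        exact absurd hc v.2
    · rw [if_neg h]
      refine Finset.sum_eq_zero fun i _ => ?_
      by_cases h1 : w.take i = [j]
      · rw [if_neg (c := w.drop i = v.1), mul_zero]
        intro h2
        apply h
        rw [← List.take_append_drop i w, h1, h2]
        rfl
      · simp [h1]
  exact LinearMap.congr_fun this x

/-- A unital morphism preserves the span of the words containing the unit. -/
lemma IsUnitalCInf.mem_of_mem {deg : ι → ℤ} {m : List ι → (ι →₀ k)} {e : ι}
    {F : Module.End k (T k ι)} (hF : IsUnitalCInf deg m e F) (v : List ι) (hv : v ≠ [])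
    (hev : e ∉ v) : ∀ w : List ι, e ∈ w → F (word k w) ⟨v, hv⟩ = 0 := by
  classical
  induction v with
  | nil => exact absurd rfl hv
  | cons j v ih =>
    have hje : e ≠ j := fun h => hev (by simp [h])
    have hsingle : ∀ w : List ι, e ∈ w → F (word k w) ⟨[j], by simp⟩ = 0 := by
      intro w hw
      rw [← proj_apply]
      by_cases hl : 2 ≤ w.length
      · rw [hF.unit_zero w hl hw]
        rfl
      · have : w = [e] := by
          rcases w with _ | ⟨a, _ | ⟨b, w⟩⟩
          · simp at hw
          · simpa [eq_comm] using hw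
          · simp at hl
        rw [this, hF.unit_one, Finsupp.single_eq_of_ne' hje]
    by_cases hv' : v = []
    · subst hv'
      exact hsingle
    · intro w hw
      have hw0 : w ≠ [] := List.ne_nil_of_mem hw
      have hev' : e ∉ v := fun h => hev (by simp [h])
      rw [← coeff_comul j ⟨v, hv'⟩, hF.comul, TBar.comul, lift_word _ hw0]
      simp only [map_sum, TensorProduct.map_tmul, LinearMap.mul'_apply]
      refine Finset.sum_eq_zero fun i _ => ?_
      have : e ∈ w.take i ∨ e ∈ w.drop i := by
        rw [← List.mem_append, List.take_append_drop]
        exact hw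
      rcases this with h | h
      · have := hsingle _ h
        simp [coeff, this]
      · have := ih hv' hev' _ h
        simp [coeff, this]

lemma IsUnitalCInf.one (deg : ι → ℤ) (m : List ι → (ι →₀ k)) (e : ι) :
    IsUnitalCInf deg m e (1 : Module.End k (T k ι)) where
  degree w v h := by
    classical
    rw [Module.End.one_apply, word_eq, Finsupp.single_apply] at h
    have : w = v := by
      by_contra hne
      simp [hne] at h
    rw [this]
  comul x := by simp [Module.End.one_eq_id]
  shuffle _ _ := rfl
  coder _ := rfl
  unit_one := by
    rw [Module.End.one_apply, proj, lift_word _ (by simp)]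
  unit_zero w hw _ := by
    rcases w with _ | ⟨a, _ | ⟨b, w⟩⟩
    · simp at hw
    · simp at hw
    · rw [Module.End.one_apply, proj, lift_word _ (by simp)]

lemma IsUnitalCInf.mul {deg : ι → ℤ} {m : List ι → (ι →₀ k)} {e : ι}
    {G F : Module.End k (T k ι)} (hG : IsUnitalCInf deg m e G) (hF : IsUnitalCInf deg m e F) :
    IsUnitalCInf deg m e (G * F) where
  degree w v h := by
    rw [Module.End.mul_apply, eq_sum (F (word k w.1)), Finsupp.sum, map_sum,
      Finsupp.finsetSum_apply] at h
    obtain ⟨u, hu, hu'⟩ := Finset.exists_ne_zero_of_sum_ne_zero h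
    rw [map_smul, Finsupp.smul_apply, smul_eq_mul] at hu'
    rw [hG.degree u v (right_ne_zero_of_mul hu'), hF.degree w u (left_ne_zero_of_mul hu')]
  comul x := by
    rw [Module.End.mul_apply, hG.comul, hF.comul, ← LinearMap.comp_apply, ← TensorProduct.map_comp]
    rfl
  shuffle x y := by simp only [Module.End.mul_apply, hG.shuffle, hF.shuffle]
  coder x := by simp only [Module.End.mul_apply, hG.coder, hF.coder]
  unit_one := by
    classical
    have key : F (word k [e]) = word k [e] := by
      rw [word_eq ⟨[e], by simp⟩]
      ext ⟨v, hv⟩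
      rw [← word_eq]
      rcases v with _ | ⟨a, _ | ⟨b, v⟩⟩
      · exact absurd rfl hv
      · rw [← proj_apply, hF.unit_one, word_eq]
        simp [Finsupp.single_apply, Subtype.ext_iff]
      · have h1 := coeff_comul (k := k) a ⟨b :: v, by simp⟩ (F (word k [e]))
        rw [hF.comul, TBar.comul, lift_word _ (by simp)] at h1
        rw [← h1, word_eq]
        simp [word, Subtype.ext_iff]
    rw [Module.End.mul_apply, key, hG.unit_one]
  unit_zero w hw hew := by
    rw [Module.End.mul_apply, eq_sum (F (word k w)), Finsupp.sum, map_sum, map_sum]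
    refine Finset.sum_eq_zero fun u hu => ?_
    have hu0 : F (word k w) u ≠ 0 := Finsupp.mem_support_iff.1 hu
    have heu : e ∈ u.1 := by
      by_contra hc
      exact hu0 (hF.mem_of_mem u.1 u.2 hc w hew)
    have hlu : 2 ≤ u.1.length := by
      obtain ⟨u, hune⟩ := u
      rcases u with _ | ⟨a, _ | ⟨b, u⟩⟩
      · exact absurd rfl hune
      · exfalso
        apply hu0
        rw [← proj_apply, hF.unit_zero w hw hew]
        rfl
      · simp
    rw [map_smul, map_smul, hG.unit_zero u.1 hlu heu, smul_zero]

end lemmas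

/-- The monoid of unital `C∞` endomorphisms. -/
def unitalCInfEnd {k ι : Type*} [Field k] (deg : ι → ℤ) (m : List ι → (ι →₀ k)) (e : ι) :
    Submonoid (Module.End k (T k ι)) where
  carrier := {F | IsUnitalCInf deg m e F}
  one_mem' := IsUnitalCInf.one deg m e
  mul_mem' hG hF := IsUnitalCInf.mul hG hF

end TBar

/-! ### The `C∞` algebra of Whitney forms and its automorphisms -/

namespace Whitney

/-- Degrees of the basis elements in the suspension of the Whitney forms:
`|𝐬 1| = |𝐬 t| = -1` and `|𝐬 dt| = 0`. -/
def sdeg : Letter → ℤ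
  | .one => -1
  | .t => -1
  | .dt => 0

/-- The Taylor coefficients `m₁, m₂, m₃, …` of the `C∞` structure on Whitney forms, evaluated on
words in the basis elements `𝐬 1, 𝐬 t, 𝐬 dt`. -/
def taylor (k : Type*) [Field k] : List Letter → (Letter →₀ k)
  | [] => 0
  -- `m₁ = - 𝐬 d`
  | [.one] => 0
  | [.t] => - Finsupp.single .dt 1
  | [.dt] => 0
  -- `1` is a unit: `m₂ (𝐬 1 ⊗ 𝐬 x) = 𝐬 x` and `m₂ (𝐬 x ⊗ 𝐬 1) = (-1)^|x| 𝐬 x`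
  | [.one, x] => Finsupp.single x 1
  | [.t, .one] => Finsupp.single .t 1
  | [.dt, .one] => - Finsupp.single .dt 1
  | [.t, .t] => Finsupp.single .t 1
  -- with `i` arguments `𝐬 dt` in front of the only `𝐬 t`, and `n` arguments `𝐬 dt` in total
  | w =>
      if Letter.one ∉ w ∧ w.count Letter.t = 1 then
        Finsupp.single .dt
          ((-1) ^ (w.idxOf Letter.t + 1) * ((w.length - 1).choose (w.idxOf Letter.t) : k) *
            ((_root_.bernoulli (w.length - 1) : ℚ) : k) / ((w.length - 1).factorial : k))
      else 0

/-- The group of unital `C∞` automorphisms of the `C∞` algebra of Whitney forms. -/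
abbrev AutInf (k : Type*) [Field k] : Type _ :=
  (TBar.unitalCInfEnd sdeg (taylor k) Letter.one)ˣ

/-- The linear part `ψ₁`, the first Taylor coefficient of `ψ`, as an endomorphism of the space of
Whitney forms. -/
def linearPart {k : Type*} [Field k] (ψ : Module.End k (TBar.T k Letter)) :
    Module.End k (forms k) :=
  (basis k).repr.symm.toLinearMap ∘ₗ TBar.proj k Letter ∘ₗ ψ ∘ₗ TBar.incl k Letter ∘ₗ
    (basis k).repr.toLinearMap

/-- The action of `kˣ` on the additive group of `k` by multiplication. -/
def scaling (k : Type*) [Field k] : kˣ →* MulAut (Multiplicative k) where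
  toFun u := AddEquiv.toMultiplicative (DistribMulAction.toAddAut kˣ k u)
  map_one' := by ext x; simp
  map_mul' u v := by
    apply MulEquiv.ext
    intro x
    apply Multiplicative.toAdd.injective
    simp [mul_smul]

end Whitney

end

/-! The argument is dual. On the full tensor coalgebra, the operators commuting with the right
coaction form, under composition, the algebra of noncommutative power series in the letter-removing
operators `del j`. A family of such operators `D j`, each shortening words, determines a coalgebra
endomorphism `F` by the substitution rule `del j * F = F * D j` (`cofree`). Properties of `F` become
properties of the `D j`: skew derivations of the shuffle product give multiplicativity
(`shuffle_cofree`), and `F` commutes with the coderivation `M` once the `D j` obey the commutation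
rules with `M` that the `del j` obey (`cofree_coderF`).

For the Whitney forms these rules describe the Lawrence–Sullivan interval. Put `x = del dt`, `τ =
del t`, `d = M - del one`, and let `B(z) = z / (exp z - 1)`. Then `[x, d] = -B(ad x) τ` and `τ d + d
τ = τ τ`: `τ` is a Maurer–Cartan element reached from zero by the gauge flow of `x` in unit time. At
time `s` the flow is at `ω_s`, the series `(exp (s z) - 1) / (exp z - 1)` at `z = ad x` applied to
`τ`, and every `ω_s` is again Maurer–Cartan (`gauge_flow`).

Existence: the affine map sending the endpoints 0 and 1 to `s` and `s'` is realised by the piece of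
the flow line between these times, that is by `del one + ω_s`, `ω_{s'} - ω_s` and `(s' - s) x`
(`affineMorphism_isUnitalCInf`). Setting `s = b`, `s' = a + b` gives the linear part `t ↦ a t + b`,
and every endomorphism of the complex fixing 1 is of this form.

Uniqueness (`isUnitalCInf_ext`) is an induction on word length. If two morphisms agree on shorter
words, their difference on the next length consists of Taylor coefficients. Unitality kills words
containing 1, the degree kills words with two letters `t`, and vanishing on shuffles kills powers of
`dt` and leaves one unknown for the words with one `t`. Compatibility with `M` on `t t dt ⋯ dt`
removes that unknown in characteristic zero.

Taking the linear part is thus already bijective on the monoids of endomorphisms. The groups follow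
by passing to units, and the affine group is then computed by evaluating forms at points. -/

noncomputable section

/-! ### The full tensor coalgebra and its word derivatives -/

namespace TBar

/-- The full tensor coalgebra, with its basis of all words. -/
def Full (k ι : Type*) [Field k] : Type _ := List ι →₀ k

section full

variable {k ι : Type*} [Field k]

instance : AddCommGroup (Full k ι) := inferInstanceAs (AddCommGroup (List ι →₀ k))

instance : Module k (Full k ι) := inferInstanceAs (Module k (List ι →₀ k))

instance : FunLike (Full k ι) (List ι) k := inferInstanceAs (FunLike (List ι →₀ k) (List ι) k)

namespace Full

@[ext]
lemma ext {x y : Full k ι} (h : ∀ w, x w = y w) : x = y := DFunLike.ext _ _ h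

@[simp]
protected lemma zero_apply (w : List ι) : (0 : Full k ι) w = 0 := rfl

@[simp]
protected lemma add_apply (x y : Full k ι) (w : List ι) : (x + y) w = x w + y w := rfl

@[simp]
protected lemma smul_apply (c : k) (x : Full k ι) (w : List ι) : (c • x) w = c * x w := rfl

/-- The coefficient of a word in the full tensor coalgebra. -/
def wcoeff (k : Type*) [Field k] {ι : Type*} (w : List ι) : Full k ι →ₗ[k] k where
  toFun x := x w
  map_add' _ _ := rfl
  map_smul' _ _ := rfl

@[simp]
lemma wcoeff_apply (w : List ι) (x : Full k ι) : wcoeff k w x = x w := rfl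

@[simp]
protected lemma sum_apply {α : Type*} (s : Finset α) (f : α → Full k ι) (w : List ι) :
    (∑ i ∈ s, f i) w = ∑ i ∈ s, f i w := map_sum (wcoeff k w) f s

lemma finite_support (x : Full k ι) : (Function.support x).Finite :=
  Finsupp.hasFiniteSupport (show List ι →₀ k from x)

/-- An element of the full tensor coalgebra from its coefficients. -/
def ofFun (f : List ι → k) (hf : (Function.support f).Finite) : Full k ι :=
  Finsupp.ofSupportFinite f hf

lemma ofFun_apply (f : List ι → k) (hf : (Function.support f).Finite) (w : List ι) :
    ofFun f hf w = f w := rfl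

/-- The linear map with prescribed values on the basis of words. -/
def lin {M : Type*} [AddCommGroup M] [Module k M] (f : List ι → M) : Full k ι →ₗ[k] M where
  toFun := Finsupp.linearCombination k f
  map_add' := map_add (Finsupp.linearCombination k f)
  map_smul' := map_smul (Finsupp.linearCombination k f)

/-- Precomposition of the coefficients with an injective map on words. -/
def pull (k : Type*) [Field k] {ι : Type*} (g : List ι → List ι) (hg : Function.Injective g) :
    Module.End k (Full k ι) where
  toFun x := ofFun (fun w => x (g w)) (x.finite_support.preimage hg.injOn)
  map_add' _ _ := Full.ext fun _ => rfl
  map_smul' _ _ := Full.ext fun _ => rfl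

end Full

open Full

/-- The basis element of the full tensor coalgebra given by a word. -/
def wd (k : Type*) [Field k] {ι : Type*} (w : List ι) : Full k ι :=
  Finsupp.single (M := k) w 1

lemma wd_apply [DecidableEq ι] (w v : List ι) : wd k w v = if w = v then 1 else 0 :=
  Finsupp.single_apply

lemma lin_wd {M : Type*} [AddCommGroup M] [Module k M] (f : List ι → M) (w : List ι) :
    lin (k := k) f (wd k w) = f w :=
  (Finsupp.linearCombination_single k (1 : k) w).trans (one_smul k _)

lemma full_eq_sum (x : Full k ι) : x = ∑ w ∈ x.finite_support.toFinset, x w • wd k w := by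
  classical
  ext v
  simp only [Full.sum_apply, Full.smul_apply, wd_apply]
  rw [Finset.sum_eq_single v]
  · simp
  · intro w _ hw
    simp [hw]
  · intro h
    simpa using h

lemma full_hom_ext {M : Type*} [AddCommGroup M] [Module k M] {f g : Full k ι →ₗ[k] M}
    (h : ∀ w, f (wd k w) = g (wd k w)) : f = g := by
  refine LinearMap.ext fun x => ?_
  rw [full_eq_sum x, map_sum, map_sum]
  simp only [map_smul, h]

/-- The operator removing a letter from the front of a word. -/
def del (k : Type*) [Field k] {ι : Type*} (j : ι) : Module.End k (Full k ι) :=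
  pull k (List.cons j) List.cons_injective

lemma del_apply (j : ι) (x : Full k ι) (v : List ι) : del k j x v = x (j :: v) := rfl

lemma del_wd_nil (j : ι) : del k j (wd k []) = 0 := by
  classical
  ext v
  simp [del_apply, wd_apply]

lemma del_wd_cons [DecidableEq ι] (j a : ι) (w : List ι) :
    del k j (wd k (a :: w)) = if a = j then wd k w else 0 := by
  ext v
  split_ifs with h <;> simp [del_apply, wd_apply, h]

/-- The induction principle behind most identities below: after taking one derivative, both sides
can be compared on shorter words. -/
lemma ext_del {x y : Full k ι} (h0 : x [] = y []) (h : ∀ j, del k j x = del k j y) : x = y := by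
  ext v
  cases v with
  | nil => exact h0
  | cons j v => exact DFunLike.congr_fun (h j) v

/-- Left tensoring with a basis element, on the full tensor coalgebra. -/
def consF (k : Type*) [Field k] {ι : Type*} (j : ι) : Module.End k (Full k ι) :=
  lin fun w => wd k (j :: w)

lemma consF_wd (j : ι) (w : List ι) : consF k j (wd k w) = wd k (j :: w) := lin_wd _ _

lemma consF_nil (j : ι) (x : Full k ι) : consF k j x [] = 0 := by
  classical
  have : wcoeff k [] ∘ₗ consF k j = 0 := full_hom_ext fun w => by
    simp [consF_wd, wd_apply]
  exact LinearMap.congr_fun this x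

lemma del_consF [DecidableEq ι] (i j : ι) (x : Full k ι) :
    del k i (consF k j x) = if j = i then x else 0 := by
  have : del k i ∘ₗ consF k j = if j = i then LinearMap.id else 0 := full_hom_ext fun w => by
    rw [LinearMap.comp_apply, consF_wd, del_wd_cons]
    split_ifs <;> rfl
  rw [← LinearMap.comp_apply, this]
  split_ifs <;> rfl

/-- The elements supported on the words of length less than `n`. -/
def lenLT (k ι : Type*) [Field k] (n : ℕ) : Submodule k (Full k ι) where
  carrier := {x | ∀ w : List ι, n ≤ w.length → x w = 0}
  add_mem' hx hy w hw := by rw [Full.add_apply, hx w hw, hy w hw, add_zero]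
  zero_mem' _ _ := rfl
  smul_mem' c x hx w hw := by rw [Full.smul_apply, hx w hw, mul_zero]

lemma mem_lenLT {n : ℕ} {x : Full k ι} :
    x ∈ lenLT k ι n ↔ ∀ w : List ι, n ≤ w.length → x w = 0 := Iff.rfl

lemma wd_mem_lenLT {n : ℕ} {w : List ι} (h : w.length < n) : wd k w ∈ lenLT k ι n := by
  classical
  intro v hv
  rw [wd_apply, if_neg]
  rintro rfl
  omega

lemma wd_mem_induction {n : ℕ} {p : Full k ι → Prop} (h0 : p 0) (ha : ∀ x y, p x → p y → p (x + y))
    (hs : ∀ (c : k) x, p x → p (c • x)) (hw : ∀ w : List ι, w.length < n → p (wd k w))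
    {x : Full k ι} (hx : x ∈ lenLT k ι n) : p x := by
  rw [full_eq_sum x]
  refine Finset.sum_induction _ p ha h0 fun w hw' => hs _ _ (hw w ?_)
  by_contra h
  rw [Set.Finite.mem_toFinset] at hw'
  exact hw' (hx w (not_lt.1 h))

lemma lenLT_mono {m n : ℕ} (h : m ≤ n) : lenLT k ι m ≤ lenLT k ι n := fun _ hx =>
  mem_lenLT.2 fun w hw => mem_lenLT.1 hx w (h.trans hw)

lemma eq_zero_of_mem_lenLT_zero {x : Full k ι} (h : x ∈ lenLT k ι 0) : x = 0 := by
  ext w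
  exact mem_lenLT.1 h w (Nat.zero_le _)

lemma exists_mem_lenLT (x : Full k ι) : ∃ n, x ∈ lenLT k ι n := by
  refine ⟨x.finite_support.toFinset.sup List.length + 1, mem_lenLT.2 fun w hw => ?_⟩
  by_contra h
  have := Finset.le_sup (f := List.length) (x.finite_support.mem_toFinset.2 h)
  omega

/-- Operators shortening every word. -/
def Lowers (D : Module.End k (Full k ι)) : Prop :=
  ∀ n, ∀ x ∈ lenLT k ι (n + 1), D x ∈ lenLT k ι n

/-- The algebra of operators that do not lengthen words. -/
def filtered (k ι : Type*) [Field k] : Subalgebra k (Module.End k (Full k ι)) where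
  carrier := {D | ∀ n, ∀ x ∈ lenLT k ι n, D x ∈ lenLT k ι n}
  mul_mem' ha hb n x hx := ha n _ (hb n x hx)
  add_mem' ha hb n x hx := Submodule.add_mem _ (ha n x hx) (hb n x hx)
  algebraMap_mem' c n x hx := by
    rw [Module.algebraMap_end_apply]
    exact Submodule.smul_mem _ _ hx

lemma Lowers.mem_filtered {D : Module.End k (Full k ι)} (h : Lowers D) : D ∈ filtered k ι := by
  intro n x hx
  cases n with
  | zero => rw [eq_zero_of_mem_lenLT_zero hx, map_zero]; exact Submodule.zero_mem _
  | succ n => exact lenLT_mono n.le_succ (h n x hx)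

lemma Lowers.smul {D : Module.End k (Full k ι)} (h : Lowers D) (c : k) : Lowers (c • D) :=
  fun n x hx => Submodule.smul_mem _ c (h n x hx)

lemma Lowers.add {D E : Module.End k (Full k ι)} (h : Lowers D) (h' : Lowers E) :
    Lowers (D + E) := fun n x hx => Submodule.add_mem _ (h n x hx) (h' n x hx)

lemma Lowers.sub {D E : Module.End k (Full k ι)} (h : Lowers D) (h' : Lowers E) :
    Lowers (D - E) := fun n x hx => Submodule.sub_mem _ (h n x hx) (h' n x hx)

lemma del_lowers (j : ι) : Lowers (del k j) := fun _ _ hx =>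
  mem_lenLT.2 fun w hw => mem_lenLT.1 hx (j :: w) (by simpa using hw)

/-! ### Operators commuting with the right coaction -/

/-- The operator removing a given word from the end of a word. -/
def dropEnd (k : Type*) [Field k] {ι : Type*} (v : List ι) : Module.End k (Full k ι) :=
  pull k (fun u => u ++ v) (List.append_left_injective v)

lemma dropEnd_apply (v : List ι) (x : Full k ι) (u : List ι) : dropEnd k v x u = x (u ++ v) := rfl

/-- The algebra of operators which commute with the right coaction of the tensor coalgebra. -/
def colinear (k ι : Type*) [Field k] : Subalgebra k (Module.End k (Full k ι)) :=
  Subalgebra.centralizer k (Set.range (dropEnd k))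

lemma colinear_apply {D : Module.End k (Full k ι)} (hD : D ∈ colinear k ι) (v : List ι)
    (x : Full k ι) : dropEnd k v (D x) = D (dropEnd k v x) :=
  LinearMap.congr_fun (Subalgebra.mem_centralizer_iff k |>.1 hD _ ⟨v, rfl⟩) x

lemma mem_colinear {D : Module.End k (Full k ι)}
    (h : ∀ v x, dropEnd k v (D x) = D (dropEnd k v x)) : D ∈ colinear k ι := by
  rw [colinear, Subalgebra.mem_centralizer_iff]
  rintro _ ⟨v, rfl⟩
  exact LinearMap.ext (h v)

lemma del_mem_colinear (j : ι) : del k j ∈ colinear k ι :=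
  mem_colinear fun _ _ => Full.ext fun _ => rfl

lemma dropEnd_mem_filtered (v : List ι) : dropEnd k v ∈ filtered k ι := fun _ _ hx =>
  mem_lenLT.2 fun w hw => mem_lenLT.1 hx (w ++ v) (by rw [List.length_append]; omega)

lemma dropEnd_wd [DecidableEq ι] (v w : List ι) :
    dropEnd k v (wd k w) =
      ∑ i ∈ Finset.range (w.length + 1), if w.drop i = v then wd k (w.take i) else 0 := by
  by_cases h : v <:+ w
  · obtain ⟨u, rfl⟩ := h
    rw [Finset.sum_eq_single u.length]
    · ext z
      simp [dropEnd_apply, wd_apply]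
    · intro i hi hne
      rw [if_neg]
      intro hc
      have := congrArg List.length hc
      simp at this hi
      omega
    · simp
  · rw [Finset.sum_eq_zero]
    · ext z
      rw [dropEnd_apply, wd_apply, if_neg]
      · rfl
      · rintro rfl
        exact h ⟨z, rfl⟩
    · intro i _
      rw [if_neg]
      rintro rfl
      exact h (List.drop_suffix i w)

/-- An operator commuting with the right coaction is determined by its counit part. -/
lemma colinear_wd {D : Module.End k (Full k ι)} (hD : D ∈ colinear k ι) (w : List ι) :
    D (wd k w) = ∑ i ∈ Finset.range (w.length + 1), D (wd k (w.take i)) [] • wd k (w.drop i) := by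
  classical
  ext z
  -- The coefficient at `z` is the counit after removing the suffix `z`; moving this removal past
  -- `D` leaves only the prefix complementary to `z`.
  have h := colinear_apply hD z (wd k w)
  have h1 := DFunLike.congr_fun h []
  rw [dropEnd_apply, List.nil_append] at h1
  rw [h1, dropEnd_wd, map_sum, Full.sum_apply, Full.sum_apply]
  refine Finset.sum_congr rfl fun i _ => ?_
  rw [Full.smul_apply, wd_apply]
  split_ifs <;> simp

/-! ### The coalgebra endomorphism with prescribed twisted word derivatives -/

/-- Iterated twisted derivatives along a word. -/
def iterDel (D : ι → Module.End k (Full k ι)) : List ι → Module.End k (Full k ι)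
  | [] => 1
  | j :: v => iterDel D v * D j

/-- The order is reversed because the first letter of a word is removed first. -/
lemma iterDel_append (D : ι → Module.End k (Full k ι)) (u v : List ι) :
    iterDel D (u ++ v) = iterDel D v * iterDel D u := by
  induction u with
  | nil => simp [iterDel]
  | cons j u ih => rw [List.cons_append, iterDel, iterDel, ih, mul_assoc]

lemma iterDel_mem_lenLT {D : ι → Module.End k (Full k ι)} (hD : ∀ j, Lowers (D j)) (v : List ι) :
    ∀ n, ∀ x ∈ lenLT k ι (n + v.length), iterDel D v x ∈ lenLT k ι n := by
  induction v with
  | nil => exact fun n x hx => hx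
  | cons j v ih =>
    intro n x hx
    exact ih n _ (hD j _ _ hx)

lemma iterDel_eq_zero {D : ι → Module.End k (Full k ι)} (hD : ∀ j, Lowers (D j)) {v : List ι}
    {n : ℕ} (hn : n ≤ v.length) {x : Full k ι} (hx : x ∈ lenLT k ι n) : iterDel D v x = 0 :=
  eq_zero_of_mem_lenLT_zero (iterDel_mem_lenLT hD v 0 x (lenLT_mono (by omega) hx))

lemma iterDel_mem_colinear {D : ι → Module.End k (Full k ι)} (hD : ∀ j, D j ∈ colinear k ι)
    (v : List ι) : iterDel D v ∈ colinear k ι := by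
  induction v with
  | nil => exact Subalgebra.one_mem _
  | cons j v ih => exact Subalgebra.mul_mem _ ih (hD j)

variable [Finite ι]

/-- The endomorphism `F` of the full tensor coalgebra such that removing the letter `j` after `F`
is the same as applying `D j` before `F`. -/
def cofree (D : ι → Module.End k (Full k ι)) (hD : ∀ j, Lowers (D j)) :
    Module.End k (Full k ι) where
  toFun x := ofFun (fun v => iterDel D v x []) <| by
    obtain ⟨n, hn⟩ := exists_mem_lenLT x
    refine (List.finite_length_lt ι n).subset fun v hv => ?_
    by_contra h
    exact hv (DFunLike.congr_fun (iterDel_eq_zero hD (not_lt.1 h) hn) [])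
  map_add' x y := by
    ext v
    simp [ofFun_apply]
  map_smul' c x := by
    ext v
    simp [ofFun_apply]

variable {D : ι → Module.End k (Full k ι)} (hD : ∀ j, Lowers (D j))

lemma cofree_apply (x : Full k ι) (v : List ι) : cofree D hD x v = iterDel D v x [] := rfl

lemma cofree_nil (x : Full k ι) : cofree D hD x [] = x [] := rfl

lemma del_cofree (j : ι) (x : Full k ι) : del k j (cofree D hD x) = cofree D hD (D j x) :=
  Full.ext fun _ => rfl

lemma cofree_mem_filtered : cofree D hD ∈ filtered k ι := fun _ x hx =>
  mem_lenLT.2 fun v hv => by rw [cofree_apply, iterDel_eq_zero hD hv hx]; rfl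

/-- This is compatibility with deconcatenation, read off on coefficients. Colinearity makes the
iterated derivative along `u` consume a prefix of `w` and leave the suffix untouched for `v`. -/
lemma cofree_wd_append (hc : ∀ j, D j ∈ colinear k ι) (w u v : List ι) :
    cofree D hD (wd k w) (u ++ v) = ∑ i ∈ Finset.range (w.length + 1),
      cofree D hD (wd k (w.take i)) u * cofree D hD (wd k (w.drop i)) v := by
  simp only [cofree_apply, iterDel_append, Module.End.mul_apply]
  rw [colinear_wd (iterDel_mem_colinear hc u) w]
  simp [map_sum, Full.sum_apply]

end full

end TBar

/-! ### Grading and the shuffle product on the full tensor coalgebra -/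

namespace TBar

open Full

section shuffle

variable {k ι : Type*} [Field k] (deg : ι → ℤ)

lemma sgn_zero : sgn k 0 = 1 := by simp [sgn]

lemma sgn_add (m n : ℤ) : sgn k (m + n) = sgn k m * sgn k n := by
  simp [sgn, Int.negOnePow_add]

lemma wdeg_nil : wdeg deg [] = 0 := rfl

lemma wdeg_cons (a : ι) (w : List ι) : wdeg deg (a :: w) = deg a + wdeg deg w := by
  simp [wdeg]

/-- The elements of a given degree. -/
def ofDeg (k : Type*) [Field k] (n : ℤ) : Submodule k (Full k ι) where
  carrier := {x | ∀ w : List ι, wdeg deg w ≠ n → x w = 0}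
  add_mem' hx hy w hw := by rw [Full.add_apply, hx w hw, hy w hw, add_zero]
  zero_mem' _ _ := rfl
  smul_mem' c x hx w hw := by rw [Full.smul_apply, hx w hw, mul_zero]

variable {deg}

lemma mem_ofDeg {n : ℤ} {x : Full k ι} :
    x ∈ ofDeg deg k n ↔ ∀ w : List ι, wdeg deg w ≠ n → x w = 0 := Iff.rfl

variable (deg) in
lemma wd_mem_ofDeg (w : List ι) : wd k w ∈ ofDeg deg k (wdeg deg w) := by
  classical
  intro v hv
  rw [wd_apply, if_neg]
  rintro rfl
  exact hv rfl

variable (deg) in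
/-- Operators lowering the degree by `r`. -/
def lowersDeg (r : ℤ) : Submodule k (Module.End k (Full k ι)) where
  carrier := {D | ∀ n, ∀ x ∈ ofDeg deg k n, D x ∈ ofDeg deg k (n - r)}
  add_mem' ha hb n x hx := Submodule.add_mem _ (ha n x hx) (hb n x hx)
  zero_mem' _ _ _ := Submodule.zero_mem _
  smul_mem' c _ ha n x hx := Submodule.smul_mem _ c (ha n x hx)

lemma lowersDeg_mul {r s : ℤ} {D E : Module.End k (Full k ι)} (hD : D ∈ lowersDeg deg r)
    (hE : E ∈ lowersDeg deg s) : D * E ∈ lowersDeg deg (r + s) := by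
  intro n x hx
  have := hD _ _ (hE n x hx)
  rwa [show n - (r + s) = n - s - r by ring]

lemma del_mem_lowersDeg (j : ι) : del k j ∈ lowersDeg deg (deg j) := by
  intro n x hx
  refine mem_ofDeg.2 fun w hw => mem_ofDeg.1 hx (j :: w) ?_
  rw [wdeg_cons]
  intro h
  exact hw (by rw [← h]; ring)

lemma iterDel_mem_lowersDeg {D : ι → Module.End k (Full k ι)}
    (hD : ∀ j, D j ∈ lowersDeg deg (deg j)) (v : List ι) :
    iterDel D v ∈ lowersDeg deg (wdeg deg v) := by
  induction v with
  | nil => intro n x hx; rw [wdeg_nil, sub_zero]; exact hx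
  | cons j v ih => rw [wdeg_cons, add_comm]; exact lowersDeg_mul ih (hD j)

lemma cofree_wd_degree [Finite ι] {D : ι → Module.End k (Full k ι)} (hl : ∀ j, Lowers (D j))
    (hD : ∀ j, D j ∈ lowersDeg deg (deg j)) {w v : List ι} (h : cofree D hl (wd k w) v ≠ 0) :
    wdeg deg v = wdeg deg w := by
  by_contra hne
  have h1 := iterDel_mem_lowersDeg hD v _ _ (wd_mem_ofDeg deg w)
  apply h
  rw [cofree_apply]
  refine mem_ofDeg.1 h1 [] ?_
  rw [wdeg_nil]
  intro h2
  exact hne (by linarith)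

variable (deg) in
/-- The operator `w ↦ (-1)^(r |w|) w`. -/
def signOp (k : Type*) [Field k] (r : ℤ) : Module.End k (Full k ι) :=
  lin fun w => sgn k (r * wdeg deg w) • wd k w

lemma signOp_wd (r : ℤ) (w : List ι) :
    signOp deg k r (wd k w) = sgn k (r * wdeg deg w) • wd k w := lin_wd _ _

lemma signOp_apply (r : ℤ) (x : Full k ι) (w : List ι) :
    signOp deg k r x w = sgn k (r * wdeg deg w) * x w := by
  classical
  have : (wcoeff k w).comp (signOp deg k r) =
      sgn k (r * wdeg deg w) • wcoeff k w := by
    refine full_hom_ext fun v => ?_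
    simp only [LinearMap.comp_apply, signOp_wd, LinearMap.smul_apply, wcoeff_apply,
      wd_apply, smul_eq_mul, map_smul]
    split_ifs with h
    · rw [h]
    · simp
  exact LinearMap.congr_fun this x

lemma signOp_of_mem {r n : ℤ} {x : Full k ι} (hx : x ∈ ofDeg deg k n) :
    signOp deg k r x = sgn k (r * n) • x := by
  ext w
  rw [signOp_apply, Full.smul_apply]
  by_cases h : wdeg deg w = n
  · rw [h]
  · rw [mem_ofDeg.1 hx w h, mul_zero, mul_zero]

lemma signOp_comm {r s : ℤ} {D : Module.End k (Full k ι)} (hD : D ∈ lowersDeg deg s)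
    (x : Full k ι) :
    D (signOp deg k r x) = sgn k (r * s) • signOp deg k r (D x) := by
  have : D ∘ₗ signOp deg k r = sgn k (r * s) • (signOp deg k r ∘ₗ D) := by
    refine full_hom_ext fun w => ?_
    simp only [LinearMap.comp_apply, LinearMap.smul_apply, signOp_wd, map_smul]
    rw [signOp_of_mem (hD _ _ (wd_mem_ofDeg deg w)), smul_smul, ← sgn_add]
    congr 2
    ring
  exact LinearMap.congr_fun this x

lemma signOp_mem_filtered (r : ℤ) : signOp deg k r ∈ filtered k ι := fun _ x hx =>
  mem_lenLT.2 fun w hw => by rw [signOp_apply, mem_lenLT.1 hx w hw, mul_zero]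

variable (deg) in
/-- The signed sum of all shuffles of two words, in the full tensor coalgebra. -/
def shuffleWordF (k : Type*) [Field k] : List ι → List ι → Full k ι
  | [], v => wd k v
  | u, [] => wd k u
  | a :: u, b :: v =>
      consF k a (shuffleWordF k u (b :: v)) +
        sgn k (deg b * wdeg deg (a :: u)) • consF k b (shuffleWordF k (a :: u) v)
  termination_by u v => u.length + v.length

lemma shuffleWordF_nil_left (v : List ι) : shuffleWordF deg k [] v = wd k v := by
  rw [shuffleWordF]

lemma shuffleWordF_nil_right (u : List ι) : shuffleWordF deg k u [] = wd k u := by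
  cases u <;> rw [shuffleWordF]
  simp

lemma shuffleWordF_cons (a b : ι) (u v : List ι) : shuffleWordF deg k (a :: u) (b :: v) =
      consF k a (shuffleWordF deg k u (b :: v)) +
        sgn k (deg b * wdeg deg (a :: u)) • consF k b (shuffleWordF deg k (a :: u) v) := by
  rw [shuffleWordF]

variable (deg) in
/-- The graded shuffle product on the full tensor coalgebra. -/
def shuffleF (k : Type*) [Field k] : Full k ι →ₗ[k] Full k ι →ₗ[k] Full k ι :=
  lin fun u =>
    lin fun v => shuffleWordF deg k u v

lemma shuffleF_wd (u v : List ι) :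
    shuffleF deg k (wd k u) (wd k v) = shuffleWordF deg k u v := by
  rw [shuffleF, lin_wd, lin_wd]

lemma shuffleF_apply_nil (x y : Full k ι) : shuffleF deg k x y [] = x [] * y [] := by
  classical
  have : (shuffleF deg k).compr₂ (wcoeff k []) =
      (LinearMap.mul k k).compl₁₂ (wcoeff k []) (wcoeff k []) := by
    refine full_hom_ext fun u => full_hom_ext fun v => ?_
    simp only [LinearMap.compr₂_apply, LinearMap.compl₁₂_apply, shuffleF_wd, wcoeff_apply,
      LinearMap.mul_apply']
    rcases u with _ | ⟨a, u⟩
    · simp [shuffleWordF_nil_left, wd_apply]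
    · rcases v with _ | ⟨b, v⟩
      · simp [shuffleWordF_nil_right, wd_apply]
      · rw [shuffleWordF_cons]
        simp [consF_nil, wd_apply]
  exact LinearMap.congr_fun₂ this x y

variable (deg) in
/-- Skew derivations of the shuffle product, with sign given by the degree `r`. -/
def skewDer (k : Type*) [Field k] (r : ℤ) : Submodule k (Module.End k (Full k ι)) where
  carrier := {D | ∀ x y, D (shuffleF deg k x y) =
    shuffleF deg k (D x) y + shuffleF deg k (signOp deg k r x) (D y)}
  add_mem' ha hb x y := by
    simp only [LinearMap.add_apply, ha x y, hb x y, map_add]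
    abel
  zero_mem' x y := by simp
  smul_mem' c D hD x y := by
    simp only [LinearMap.smul_apply, hD x y, map_smul, smul_add]

/-- The recursion defining shuffles chooses the first letter from one word or the other; these two
choices are the two terms of the Leibniz rule, and the sign is that of moving `j` past the left
word. -/
lemma del_mem_skewDer (j : ι) : del k j ∈ skewDer deg k (deg j) := by
  classical
  intro x y
  have : (shuffleF deg k).compr₂ (del k j) =
      (shuffleF deg k).compl₁₂ (del k j) LinearMap.id +
        (shuffleF deg k).compl₁₂ (signOp deg k (deg j)) (del k j) := by
    refine full_hom_ext fun u => full_hom_ext fun v => ?_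
    simp only [LinearMap.compr₂_apply, LinearMap.compl₁₂_apply, LinearMap.add_apply,
      LinearMap.id_apply, signOp_wd, map_smul, LinearMap.smul_apply, shuffleF_wd]
    rcases u with _ | ⟨a, u⟩
    · rcases v with _ | ⟨b, v⟩
      · simp [shuffleWordF_nil_left, del_wd_nil]
      · simp only [shuffleWordF_nil_left, del_wd_nil, wdeg_nil, mul_zero, sgn_zero, one_smul,
          map_zero, LinearMap.zero_apply, zero_add, del_wd_cons]
        split_ifs
        · rw [shuffleF_wd, shuffleWordF_nil_left]
        · simp
    · rcases v with _ | ⟨b, v⟩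
      · simp only [shuffleWordF_nil_right, del_wd_nil, map_zero, smul_zero, add_zero, del_wd_cons]
        split_ifs
        · rw [shuffleF_wd, shuffleWordF_nil_right]
        · simp
      · rw [shuffleWordF_cons, map_add, map_smul, del_consF, del_consF, del_wd_cons, del_wd_cons]
        congr 1
        · split_ifs
          · rw [shuffleF_wd]
          · simp
        · split_ifs with h
          · rw [shuffleF_wd, h]
          · simp
  exact LinearMap.congr_fun₂ this x y

/-- The commutator of a derivation and a skew derivation is a skew derivation. -/
lemma commutator_mem_skewDer {r : ℤ} {x D : Module.End k (Full k ι)} (hx : x ∈ skewDer deg k 0)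
    (hx0 : x ∈ lowersDeg deg 0) (hD : D ∈ skewDer deg k r) :
    x * D - D * x ∈ skewDer deg k r := by
  have h0 : ∀ a : Full k ι, signOp deg k 0 a = a := fun a => by
    ext w
    rw [signOp_apply, zero_mul, sgn_zero, one_mul]
  -- As `x` has degree zero it passes the sign operator freely, so the mixed terms of the two
  -- compositions cancel.
  have hc : ∀ a, x (signOp deg k r a) = signOp deg k r (x a) := fun a => by
    rw [signOp_comm hx0, mul_zero, sgn_zero, one_smul]
  intro a b
  simp only [LinearMap.sub_apply, Module.End.mul_apply, hD a b, hx a b, map_add, hx _ _, hD _ _,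
    h0, hc, map_sub]
  abel

/-- Both sides have the same counit, and by the Leibniz rules for `del j` and `D j` their
derivatives satisfy the same recursion. The induction is on the sum of the length bounds of `x` and
`y`, which each `D j` lowers. -/
lemma shuffle_cofree [Finite ι] {D : ι → Module.End k (Full k ι)} (hl : ∀ j, Lowers (D j))
    (hd : ∀ j, D j ∈ lowersDeg deg (deg j)) (hs : ∀ j, D j ∈ skewDer deg k (deg j))
    (x y : Full k ι) :
    cofree D hl (shuffleF deg k x y) = shuffleF deg k (cofree D hl x) (cofree D hl y) := by
  have hF : ∀ r x, cofree D hl (signOp deg k r x) = signOp deg k r (cofree D hl x) := by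
    intro r x
    have h0 : cofree D hl ∈ lowersDeg deg 0 := by
      intro n x hx
      rw [sub_zero]
      refine mem_ofDeg.2 fun v hv => ?_
      have h1 := iterDel_mem_lowersDeg hd v _ _ hx
      refine mem_ofDeg.1 h1 [] ?_
      rw [wdeg_nil]
      intro h2
      exact hv (by linarith)
    rw [signOp_comm h0, mul_zero, sgn_zero, one_smul]
  obtain ⟨m, hm⟩ := exists_mem_lenLT x
  obtain ⟨n, hn⟩ := exists_mem_lenLT y
  induction hN : m + n generalizing m n x y with
  | zero =>
    obtain rfl : m = 0 := by omega
    rw [eq_zero_of_mem_lenLT_zero hm]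
    simp
  | succ N ih =>
    refine ext_del ?_ fun j => ?_
    · rw [cofree_nil, shuffleF_apply_nil, shuffleF_apply_nil, cofree_nil, cofree_nil]
    · rw [del_cofree, hs j, map_add, del_mem_skewDer, del_cofree, del_cofree, ← hF]
      congr 1
      · cases m with
        | zero => rw [eq_zero_of_mem_lenLT_zero hm]; simp
        | succ m => exact ih _ _ m (hl j _ _ hm) n hn (by omega)
      · cases n with
        | zero => rw [eq_zero_of_mem_lenLT_zero hn]; simp
        | succ n =>
          exact ih _ _ m (signOp_mem_filtered _ _ _ hm) n (hl j _ _ hn) (by omega)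

end shuffle

end TBar

/-! ### Comparison of the reduced and the full tensor coalgebra -/

namespace TBar

open Full

section compare

variable {k ι : Type*} [Field k]

/-- The inclusion of the reduced into the full tensor coalgebra. -/
def emb (k ι : Type*) [Field k] : T k ι →ₗ[k] Full k ι := lift fun w => wd k w

/-- The projection of the full onto the reduced tensor coalgebra. -/
def res (k ι : Type*) [Field k] : Full k ι →ₗ[k] T k ι := lin fun w => word k w

lemma emb_word {w : List ι} (hw : w ≠ []) : emb k ι (word k w) = wd k w := lift_word _ hw

lemma res_wd (w : List ι) : res k ι (wd k w) = word k w := lin_wd _ _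

lemma res_apply (x : Full k ι) (w : {w : List ι // w ≠ []}) : res k ι x w = x w.1 := by
  classical
  have : coeff k w ∘ₗ res k ι = wcoeff k w.1 := full_hom_ext fun v => by
    rw [LinearMap.comp_apply, res_wd, coeff_word, wcoeff_apply, wd_apply]
  exact LinearMap.congr_fun this x

lemma res_emb (x : T k ι) : res k ι (emb k ι x) = x := by
  have : res k ι ∘ₗ emb k ι = LinearMap.id := hom_ext fun w hw => by
    rw [LinearMap.comp_apply, emb_word hw, res_wd, LinearMap.id_apply]
  exact LinearMap.congr_fun this x

lemma emb_apply (x : T k ι) (w : {w : List ι // w ≠ []}) : emb k ι x w.1 = x w := by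
  rw [← res_apply, res_emb]

lemma emb_nil (x : T k ι) : emb k ι x [] = 0 := by
  classical
  have : wcoeff k [] ∘ₗ emb k ι = 0 := hom_ext fun w hw => by
    rw [LinearMap.comp_apply, emb_word hw, wcoeff_apply, wd_apply, if_neg hw]
    rfl
  exact LinearMap.congr_fun this x

lemma emb_res {x : Full k ι} (hx : x [] = 0) : emb k ι (res k ι x) = x := by
  ext w
  by_cases hw : w = []
  · rw [hw, emb_nil, hx]
  · exact (emb_apply (res k ι x) ⟨w, hw⟩).trans (res_apply x ⟨w, hw⟩)

lemma emb_injective : Function.Injective (emb k ι) :=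
  Function.LeftInverse.injective (g := res k ι) res_emb

lemma word_nil : word k ([] : List ι) = 0 := by simp [word]

lemma emb_cons (a : ι) (x : T k ι) : emb k ι (cons k a x) = consF k a (emb k ι x) := by
  have : emb k ι ∘ₗ cons k a = consF k a ∘ₗ emb k ι := by
    refine hom_ext fun w hw => ?_
    simp only [LinearMap.comp_apply]
    rw [cons, lift_word _ hw, emb_word (by simp), emb_word hw, consF_wd]
  exact LinearMap.congr_fun this x

/-- The coefficient of `u ⊗ v` in the coproduct of `x` is the coefficient of `u ++ v` in `x`. -/
lemma coeff_comul_append (u v : {w : List ι // w ≠ []}) (x : T k ι) :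
    LinearMap.mul' k k (TensorProduct.map (coeff k u) (coeff k v) (comul k ι x)) =
      x ⟨u.1 ++ v.1, by simp [u.2]⟩ := by
  classical
  have : (LinearMap.mul' k k) ∘ₗ (TensorProduct.map (coeff k u) (coeff k v)) ∘ₗ comul k ι =
      coeff k (⟨u.1 ++ v.1, by simp [u.2]⟩ : {w : List ι // w ≠ []}) := by
    refine hom_ext fun w hw => ?_
    simp only [LinearMap.comp_apply, comul, lift_word _ hw, map_sum, TensorProduct.map_tmul,
      LinearMap.mul'_apply, coeff_word]
    split_ifs with h
    · subst h
      have hv := List.length_pos_of_ne_nil v.2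
      rw [Finset.sum_eq_single u.1.length]
      · simp
      · intro i hi hne
        rw [if_neg, zero_mul]
        intro hc
        have := congrArg List.length hc
        simp at this hi
        omega
      · intro hc
        simp at hc
        exact absurd hc v.2
    · refine Finset.sum_eq_zero fun i _ => ?_
      by_cases h1 : w.take i = u.1
      · rw [if_neg (c := w.drop i = v.1), mul_zero]
        intro h2
        exact h (by rw [← h1, ← h2, List.take_append_drop])
      · rw [if_neg h1, zero_mul]
  exact LinearMap.congr_fun this x

/-- Pairs of words index a basis of the tensor square, so identities of coproducts can be tested on
coefficients. -/
lemma tensor_ext {z z' : T k ι ⊗[k] T k ι}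
    (h : ∀ u v, LinearMap.mul' k k (TensorProduct.map (coeff k u) (coeff k v) z) =
      LinearMap.mul' k k (TensorProduct.map (coeff k u) (coeff k v) z')) : z = z' := by
  have key : ∀ u v, ∀ z : T k ι ⊗[k] T k ι,
      LinearMap.mul' k k (TensorProduct.map (coeff k u) (coeff k v) z) =
        finsuppTensorFinsupp' k _ _ z (u, v) := by
    intro u v z
    induction z with
    | zero => simp
    | tmul x y => simp [coeff]
    | add x y hx hy => simp only [map_add, hx, hy, Finsupp.add_apply]
  refine (finsuppTensorFinsupp' k _ _).injective ?_
  ext ⟨u, v⟩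
  rw [← key, ← key, h]

lemma emb_shuffleWord (deg : ι → ℤ) : ∀ u v : List ι, u ++ v ≠ [] →
    emb k ι (shuffleWord k deg u v) = shuffleWordF deg k u v
  | [], v, h => by rw [shuffleWord, shuffleWordF_nil_left, emb_word (by simpa using h)]
  | a :: u, [], h => by rw [shuffleWord, shuffleWordF_nil_right, emb_word (by simp)]; simp
  | a :: u, b :: v, h => by
      rw [shuffleWord, shuffleWordF_cons, map_add, map_smul, emb_cons, emb_cons,
        emb_shuffleWord deg u (b :: v) (by simp), emb_shuffleWord deg (a :: u) v (by simp)]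
  termination_by u v => u.length + v.length

lemma emb_shuffle (deg : ι → ℤ) (x y : T k ι) :
    emb k ι (shuffle k deg x y) = shuffleF deg k (emb k ι x) (emb k ι y) := by
  have : (shuffle k deg).compr₂ (emb k ι) = (shuffleF deg k).compl₁₂ (emb k ι) (emb k ι) := by
    refine hom_ext fun u hu => hom_ext fun v hv => ?_
    simp only [LinearMap.compr₂_apply, LinearMap.compl₁₂_apply]
    rw [emb_word hu, emb_word hv, shuffleF_wd, shuffle, lift_word _ hu, lift_word _ hv,
      emb_shuffleWord _ _ _ (by simp [hu])]
  exact LinearMap.congr_fun₂ this x y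

/-! ### Coderivations -/

lemma cons_word {j : ι} {w : List ι} (hw : w ≠ []) : cons k j (word k w) = word k (j :: w) := by
  rw [cons, lift_word _ hw]

/-- The sum is split according to whether the operation consumes the first letter or acts further
right; in the latter case the letter is passed with its Koszul sign. -/
lemma coder_word_cons (deg : ι → ℤ) (m : List ι → (ι →₀ k)) (a : ι) (w : List ι) :
    coder deg m (word k (a :: w)) =
      ∑ l ∈ Finset.Icc 1 (w.length + 1), (m ((a :: w).take l)).sum
        (fun j c => c • word k (j :: (a :: w).drop l)) +
      sgn k (deg a) • cons k a (coder deg m (word k w)) := by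
  rw [coder, lift_word _ (by simp), List.length_cons, Finset.sum_range_succ']
  rw [add_comm]
  congr 1
  · simp [wdeg_nil, sgn_zero]
  · by_cases hw : w = []
    · simp [hw, word_nil]
    · rw [lift_word _ hw, map_sum, Finset.smul_sum]
      refine Finset.sum_congr rfl fun i _ => ?_
      rw [map_sum, Finset.smul_sum, Nat.add_sub_add_right]
      refine Finset.sum_congr rfl fun l _ => ?_
      rw [map_smul, List.take_succ_cons, wdeg_cons, sgn_add, mul_smul, List.drop_succ_cons,
        show i + 1 + l = (i + l) + 1 by ring, List.drop_succ_cons, map_finsuppSum]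
      refine congrArg _ (congrArg _ (Finsupp.sum_congr fun j _ => ?_))
      rw [map_smul, cons_word (by simp)]
      rfl

/-- The coderivation, extended by zero to the full tensor coalgebra. -/
def coderF (deg : ι → ℤ) (m : List ι → (ι →₀ k)) : Module.End k (Full k ι) :=
  emb k ι ∘ₗ coder deg m ∘ₗ res k ι

lemma emb_coder (deg : ι → ℤ) (m : List ι → (ι →₀ k)) (x : T k ι) :
    emb k ι (coder deg m x) = coderF deg m (emb k ι x) := by
  simp [coderF, res_emb]

lemma coderF_nil (deg : ι → ℤ) (m : List ι → (ι →₀ k)) (x : Full k ι) : coderF deg m x [] = 0 :=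
  emb_nil _

lemma coderF_wd_nil (deg : ι → ℤ) (m : List ι → (ι →₀ k)) : coderF deg m (wd k []) = 0 := by
  simp [coderF, res_wd, word_nil]

lemma coderF_wd_cons (deg : ι → ℤ) (m : List ι → (ι →₀ k)) (a : ι) (w : List ι) :
    coderF deg m (wd k (a :: w)) =
      ∑ l ∈ Finset.Icc 1 (w.length + 1), (m ((a :: w).take l)).sum
        (fun j c => c • wd k (j :: (a :: w).drop l)) +
      sgn k (deg a) • consF k a (coderF deg m (wd k w)) := by
  simp only [coderF, LinearMap.comp_apply, res_wd]
  rw [coder_word_cons, map_add, map_smul, emb_cons, map_sum]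
  congr 1
  refine Finset.sum_congr rfl fun l _ => ?_
  rw [map_finsuppSum]
  refine Finsupp.sum_congr fun j _ => ?_
  rw [map_smul, emb_word (by simp)]

lemma coderF_mem_filtered (deg : ι → ℤ) (m : List ι → (ι →₀ k)) : coderF deg m ∈ filtered k ι := by
  have key : ∀ w : List ι, ∀ n, w.length < n → coderF deg m (wd k w) ∈ lenLT k ι n := by
    intro w
    induction w with
    | nil => intro n _; rw [coderF_wd_nil]; exact Submodule.zero_mem _
    | cons a w ih =>
      intro n hn
      rw [coderF_wd_cons]
      refine Submodule.add_mem _ (Submodule.sum_mem _ fun l hl => ?_) (Submodule.smul_mem _ _ ?_)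
      · refine Submodule.sum_mem _ fun j _ => Submodule.smul_mem _ _ (wd_mem_lenLT ?_)
        simp at hl hn ⊢
        omega
      · obtain _ | n := n
        · simp at hn
        · have h := ih n (by simpa using hn)
          refine wd_mem_induction (p := fun x => consF k a x ∈ lenLT k ι (n + 1)) ?_ ?_ ?_ ?_ h
          · simp
          · intro x y hx hy
            rw [map_add]
            exact Submodule.add_mem _ hx hy
          · intro c x hx
            rw [map_smul]
            exact Submodule.smul_mem _ _ hx
          · intro v hv
            rw [consF_wd]
            exact wd_mem_lenLT (by simpa using hv)
  intro n x hx
  refine wd_mem_induction (p := fun x => coderF deg m x ∈ lenLT k ι n) ?_ ?_ ?_ ?_ hx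
  · simp
  · intro x y hx hy
    rw [map_add]
    exact Submodule.add_mem _ hx hy
  · intro c x hx
    rw [map_smul]
    exact Submodule.smul_mem _ _ hx
  · exact fun w hw => key w n hw

/-- The failure of a coderivation to commute with a word derivative is given by its Taylor
coefficients. -/
lemma del_mul_coderF {deg : ι → ℤ} {m : List ι → (ι →₀ k)} {j : ι} {Q : Module.End k (Full k ι)}
    (hm : m [] = 0) (hQ : Q ∈ colinear k ι) (h : ∀ w, Q (wd k w) [] = m w j) :
    del k j * coderF deg m = Q + sgn k (deg j) • (coderF deg m * del k j) := by
  classical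
  refine full_hom_ext fun w => ?_
  simp only [LinearMap.add_apply, Module.End.mul_apply, LinearMap.smul_apply]
  rw [colinear_wd hQ]
  simp only [h]
  rcases w with _ | ⟨a, w⟩
  · simp [coderF_wd_nil, hm, del_wd_nil]
  · rw [coderF_wd_cons, map_add, map_smul, del_consF, del_wd_cons]
    congr 1
    -- The expansion of `Q` includes the empty prefix, absent from the coderivation; its term
    -- vanishes because `m [] = 0`.
    · rw [Finset.range_eq_Ico, Finset.sum_eq_sum_Ico_succ_bot (by simp), List.take_zero, hm,
        map_sum]
      simp only [Finsupp.zero_apply, zero_smul, zero_add]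
      refine Finset.sum_congr rfl fun l _ => ?_
      rw [map_finsuppSum]
      simp only [map_smul, del_wd_cons]
      rw [Finsupp.sum, Finset.sum_eq_single j]
      · simp
      · intro i _ hi
        simp [hi]
      · intro hj
        simp [Finsupp.notMem_support_iff.1 hj]
    · split_ifs with hj
      · rw [hj]
      · simp

/-! ### The endomorphism of the reduced tensor coalgebra -/

variable [Finite ι] {D : ι → Module.End k (Full k ι)} (hD : ∀ j, Lowers (D j))

/-- The restriction to the reduced tensor coalgebra of the endomorphism with prescribed twisted
word derivatives. -/
def cofreeRed (D : ι → Module.End k (Full k ι)) (hD : ∀ j, Lowers (D j)) :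
    Module.End k (T k ι) := res k ι ∘ₗ cofree D hD ∘ₗ emb k ι

lemma emb_cofreeRed (x : T k ι) : emb k ι (cofreeRed D hD x) = cofree D hD (emb k ι x) :=
  emb_res (by rw [LinearMap.comp_apply, cofree_nil, emb_nil])

lemma cofreeRed_word_apply (w : List ι) (v : {w : List ι // w ≠ []}) :
    cofreeRed D hD (word k w) v = cofree D hD (wd k w) v.1 := by
  by_cases hw : w = []
  · subst hw
    rw [word_nil, map_zero]
    have h := cofree_mem_filtered hD 1 (wd k []) (wd_mem_lenLT (by simp))
    exact (mem_lenLT.1 h _ (List.length_pos_of_ne_nil v.2)).symm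
  · rw [← emb_word hw, ← emb_cofreeRed, emb_apply]

lemma cofreeRed_comul (hc : ∀ j, D j ∈ colinear k ι) (x : T k ι) :
    comul k ι (cofreeRed D hD x) =
      TensorProduct.map (cofreeRed D hD) (cofreeRed D hD) (comul k ι x) := by
  have : comul k ι ∘ₗ cofreeRed D hD =
      TensorProduct.map (cofreeRed D hD) (cofreeRed D hD) ∘ₗ comul k ι := by
    refine hom_ext fun w hw => tensor_ext (k := k) (ι := ι) fun u v => ?_
    rw [LinearMap.comp_apply, coeff_comul_append, cofreeRed_word_apply, cofree_wd_append hD hc,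
      Finset.sum_range_succ, LinearMap.comp_apply, comul, lift_word _ hw]
    simp only [map_sum, TensorProduct.map_tmul, LinearMap.mul'_apply]
    -- The full coproduct has one more term, with empty right factor; it does not contribute since
    -- `v` is nonempty.
    have h0 : cofree D hD (wd k (w.drop w.length)) v.1 = 0 := by
      rw [← cofreeRed_word_apply hD _ v, List.drop_length, word_nil, map_zero]
      rfl
    rw [h0, mul_zero, add_zero]
    refine Finset.sum_congr rfl fun i _ => ?_
    rw [← cofreeRed_word_apply hD _ u, ← cofreeRed_word_apply hD _ v]
    rfl
  exact LinearMap.congr_fun this x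

end compare

end TBar

/-! ### Power series in the commutator with a shortening operator -/

namespace TBar

open Full

section ser

variable {k ι : Type*} [Field k]

/-- The commutator with `x`, as a linear operator on operators. -/
def ad (x : Module.End k (Full k ι)) : Module.End k (Module.End k (Full k ι)) :=
  LinearMap.mulLeft k x - LinearMap.mulRight k x

lemma ad_apply (x y : Module.End k (Full k ι)) : ad x y = x * y - y * x := rfl

/-- The power series `f` evaluated at the commutator with `x`, applied to `y`. -/
def ser (x : Module.End k (Full k ι)) (f : PowerSeries k) (y : Module.End k (Full k ι)) :
    Module.End k (Full k ι) :=
  lin fun w =>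
    ∑ n ∈ Finset.range (w.length + 1), PowerSeries.coeff n f • (ad x ^ n) y (wd k w)

variable {x y : Module.End k (Full k ι)}

lemma ad_pow_succ (n : ℕ) (y : Module.End k (Full k ι)) :
    (ad x ^ (n + 1)) y = x * (ad x ^ n) y - (ad x ^ n) y * x := by
  rw [pow_succ']
  rfl

/-- Each commutator inserts one more factor `x`, which shortens words by one. Hence high powers
vanish on words of bounded length and power series in `ad x` make sense. -/
lemma ad_pow_mem_lenLT (hx : Lowers x) (hy : y ∈ filtered k ι) (n : ℕ) :
    ∀ m, ∀ z ∈ lenLT k ι (m + n), (ad x ^ n) y z ∈ lenLT k ι m := by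
  induction n with
  | zero => exact fun m z hz => hy m z hz
  | succ n ih =>
    intro m z hz
    rw [ad_pow_succ]
    exact Submodule.sub_mem _ (hx _ _ (ih (m + 1) z (by rwa [add_right_comm] ))) (ih m _ (hx _ _ hz))

lemma ad_pow_eq_zero (hx : Lowers x) (hy : y ∈ filtered k ι) {n N : ℕ} (h : N ≤ n)
    {z : Full k ι} (hz : z ∈ lenLT k ι N) : (ad x ^ n) y z = 0 :=
  eq_zero_of_mem_lenLT_zero (ad_pow_mem_lenLT hx hy n 0 z (lenLT_mono (by omega) hz))

lemma ad_pow_mem_filtered (hx : Lowers x) (hy : y ∈ filtered k ι) (n : ℕ) :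
    (ad x ^ n) y ∈ filtered k ι := fun m z hz =>
  ad_pow_mem_lenLT hx hy n m z (lenLT_mono (by omega) hz)

/-- Any sufficiently late truncation computes the series, so a single bound can serve several
elements at once. -/
lemma ser_apply (hx : Lowers x) (hy : y ∈ filtered k ι) (f : PowerSeries k) {N K : ℕ}
    (hK : N ≤ K) {z : Full k ι} (hz : z ∈ lenLT k ι N) :
    ser x f y z = ∑ n ∈ Finset.range K, PowerSeries.coeff n f • (ad x ^ n) y z := by
  refine wd_mem_induction (p := fun z => ser x f y z =
    ∑ n ∈ Finset.range K, PowerSeries.coeff n f • (ad x ^ n) y z) ?_ ?_ ?_ ?_ hz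
  · simp
  · intro a b ha hb
    simp only [map_add, smul_add, Finset.sum_add_distrib, ha, hb]
  · intro c a ha
    simp only [map_smul, ha, Finset.smul_sum]
    exact Finset.sum_congr rfl fun n _ => smul_comm _ _ _
  · intro w hw
    have : ser x f y (wd k w) = ∑ n ∈ Finset.range (w.length + 1),
        PowerSeries.coeff n f • (ad x ^ n) y (wd k w) := lin_wd _ _
    rw [this]
    refine Finset.sum_subset (Finset.range_mono (by omega)) fun n _ hn => ?_
    rw [ad_pow_eq_zero hx hy _ (wd_mem_lenLT (Nat.lt_succ_self _)), smul_zero]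
    simpa using hn

lemma ser_ext {g h : Module.End k (Full k ι)}
    (H : ∀ N, ∀ z ∈ lenLT k ι N, g z = h z) : g = h :=
  LinearMap.ext fun z => by
    obtain ⟨N, hN⟩ := exists_mem_lenLT z
    exact H N z hN

lemma ser_mem_filtered (hx : Lowers x) (hy : y ∈ filtered k ι) (f : PowerSeries k) :
    ser x f y ∈ filtered k ι := fun N z hz => by
  rw [ser_apply hx hy f le_rfl hz]
  exact Submodule.sum_mem _ fun n _ =>
    Submodule.smul_mem _ _ (ad_pow_mem_filtered hx hy n N z hz)

lemma ser_lowers (hx : Lowers x) (hy : Lowers y) (f : PowerSeries k) : Lowers (ser x f y) := by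
  intro N z hz
  rw [ser_apply hx hy.mem_filtered f le_rfl hz]
  refine Submodule.sum_mem _ fun n _ => Submodule.smul_mem _ _ ?_
  cases n with
  | zero => exact hy N z hz
  | succ n => exact ad_pow_mem_lenLT hx hy.mem_filtered _ N z (lenLT_mono (by omega) hz)

lemma ser_add_left (hx : Lowers x) (hy : y ∈ filtered k ι) (f g : PowerSeries k) :
    ser x (f + g) y = ser x f y + ser x g y :=
  ser_ext fun N z hz => by
    rw [LinearMap.add_apply, ser_apply hx hy _ le_rfl hz, ser_apply hx hy _ le_rfl hz,
      ser_apply hx hy _ le_rfl hz, ← Finset.sum_add_distrib]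
    simp [add_smul]

lemma ser_sub_left (hx : Lowers x) (hy : y ∈ filtered k ι) (f g : PowerSeries k) :
    ser x (f - g) y = ser x f y - ser x g y := by
  rw [eq_sub_iff_add_eq, ← ser_add_left hx hy, sub_add_cancel]

lemma ser_C_mul (hx : Lowers x) (hy : y ∈ filtered k ι) (c : k) (f : PowerSeries k) :
    ser x (PowerSeries.C c * f) y = c • ser x f y :=
  ser_ext fun N z hz => by
    rw [LinearMap.smul_apply, ser_apply hx hy _ le_rfl hz, ser_apply hx hy _ le_rfl hz,
      Finset.smul_sum]
    simp [mul_smul]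

lemma ser_neg_right (hx : Lowers x) (hy : y ∈ filtered k ι) (f : PowerSeries k) :
    ser x f (-y) = - ser x f y :=
  ser_ext fun N z hz => by
    rw [LinearMap.neg_apply, ser_apply hx hy _ le_rfl hz,
      ser_apply hx (Subalgebra.neg_mem _ hy) _ le_rfl hz]
    simp

lemma ser_one (hx : Lowers x) (hy : y ∈ filtered k ι) : ser x 1 y = y :=
  ser_ext fun N z hz => by
    rw [ser_apply hx hy _ N.le_succ hz, Finset.sum_eq_single 0]
    · simp
    · intro n _ hn
      simp [PowerSeries.coeff_one, hn]
    · simp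

lemma ad_ser (hx : Lowers x) (hy : y ∈ filtered k ι) (f : PowerSeries k) (n : ℕ) {N K : ℕ}
    (hK : N ≤ K) {z : Full k ι} (hz : z ∈ lenLT k ι N) :
    (ad x ^ n) (ser x f y) z =
      ∑ m ∈ Finset.range K, PowerSeries.coeff m f • (ad x ^ (n + m)) y z := by
  induction n generalizing z with
  | zero => simpa using ser_apply hx hy f hK hz
  | succ n ih =>
    rw [ad_pow_succ, LinearMap.sub_apply, Module.End.mul_apply, Module.End.mul_apply, ih hz,
      ih (hx.mem_filtered _ _ hz), map_sum, ← Finset.sum_sub_distrib]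
    refine Finset.sum_congr rfl fun m _ => ?_
    rw [map_smul, ← smul_sub, add_right_comm, ad_pow_succ]
    rfl

/-- Together with additivity this gives a functional calculus: identities between power series
become identities between operators. -/
lemma ser_mul (hx : Lowers x) (hy : y ∈ filtered k ι) (f g : PowerSeries k) :
    ser x (f * g) y = ser x f (ser x g y) :=
  ser_ext fun N z hz => by
    rw [ser_apply hx hy _ le_rfl hz, ser_apply hx (ser_mem_filtered hx hy g) f le_rfl hz]
    simp only [ad_ser hx hy g _ le_rfl hz, PowerSeries.coeff_mul, Finset.sum_smul,
      Finset.smul_sum, smul_smul]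
    rw [← Finset.sum_product', Finset.sum_sigma']
    -- The sum over total degree below `N` is first enlarged to `N + N`, so as to contain the square
    -- of index pairs of the product; all added terms vanish.
    refine (Finset.sum_subset_zero_on_sdiff (s₁ := (Finset.range N).sigma
      fun n => Finset.HasAntidiagonal.antidiagonal n) (s₂ := ((Finset.range (N + N)).sigma
      fun n => Finset.HasAntidiagonal.antidiagonal n)) ?_ ?_ fun _ _ => rfl).trans ?_
    · exact Finset.sigma_mono (Finset.range_mono (by omega)) fun _ => le_rfl
    · rintro ⟨n, p⟩ hp
      simp at hp
      dsimp only
      rw [ad_pow_eq_zero hx hy (by omega) hz, smul_zero]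
    · symm
      refine Finset.sum_bij_ne_zero (fun p _ _ => ⟨p.1 + p.2, p⟩) ?_ ?_ ?_ ?_
      · intro p hp _
        simp at hp ⊢
        omega
      · rintro p _ _ q _ _ h
        exact eq_of_heq (Sigma.mk.inj h).2
      · rintro ⟨n, a, b⟩ hp h
        simp at hp
        refine ⟨(a, b), ?_, ?_, ?_⟩
        · simp only [Finset.mem_product, Finset.mem_range]
          by_contra hc
          apply h
          dsimp only
          rw [ad_pow_eq_zero hx hy (by omega) hz, smul_zero]
        · simpa [hp.2] using h
        · simp [hp.2]
      · intro p _ _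
        rfl

lemma ser_X (hx : Lowers x) (hy : y ∈ filtered k ι) : ser x PowerSeries.X y = x * y - y * x :=
  ser_ext fun N z hz => by
    rw [ser_apply hx hy _ (show N ≤ N + 2 by omega) hz, Finset.sum_eq_single 1]
    · simp [ad_apply]
    · intro n _ hn
      simp [PowerSeries.coeff_X, hn]
    · simp

lemma ser_smul (hx : Lowers x) (hy : y ∈ filtered k ι) (c : k) (f : PowerSeries k) :
    ser (c • x) f y = ser x (PowerSeries.rescale c f) y := by
  have had : ad (c • x) = c • ad x := by
    refine LinearMap.ext fun u => ?_
    simp [ad_apply, smul_sub]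
  refine ser_ext fun N z hz => ?_
  rw [ser_apply (hx.smul c) hy _ le_rfl hz, ser_apply hx hy _ le_rfl hz]
  refine Finset.sum_congr rfl fun n _ => ?_
  rw [had, _root_.smul_pow, PowerSeries.coeff_rescale, mul_comm, mul_smul]
  rfl

/-- The iterated Leibniz rule: `ad x` is a derivation of the composition product. -/
lemma ad_pow_mul (n : ℕ) (u v : Module.End k (Full k ι)) :
    (ad x ^ n) (u * v) = ∑ p ∈ Finset.HasAntidiagonal.antidiagonal n,
      n.choose p.1 • ((ad x ^ p.1) u * (ad x ^ p.2) v) := by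
  induction n generalizing u v with
  | zero => simp
  | succ n ih =>
    have : ad x (u * v) = ad x u * v + u * ad x v := by
      simp only [ad_apply]
      noncomm_ring
    rw [pow_succ, Module.End.mul_apply, this, map_add, ih, ih,
      Finset.sum_antidiagonal_choose_succ_nsmul
        (fun i j => (ad x ^ i) u * (ad x ^ j) v) n, add_comm]
    simp only [pow_succ, Module.End.mul_apply]
    congr 1
    refine Finset.sum_congr rfl fun p hp => ?_
    rw [Nat.choose_symm_of_eq_add (Finset.HasAntidiagonal.mem_antidiagonal.1 hp).symm]

variable [CharZero k]

/-- The exponential of the commutator with `x` is multiplicative. -/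
lemma ser_exp_mul (hx : Lowers x) (s : k) {u v : Module.End k (Full k ι)}
    (hu : u ∈ filtered k ι) (hv : v ∈ filtered k ι) :
    ser x (PowerSeries.rescale s (PowerSeries.exp k)) (u * v) =
      ser x (PowerSeries.rescale s (PowerSeries.exp k)) u *
        ser x (PowerSeries.rescale s (PowerSeries.exp k)) v := by
  refine ser_ext fun N z hz => ?_
  set E := PowerSeries.rescale s (PowerSeries.exp k) with hE
  -- This coefficient identity singles out the exponential: it absorbs the binomial coefficients of
  -- the Leibniz rule.
  have hc : ∀ n, ∀ p ∈ Finset.HasAntidiagonal.antidiagonal n, PowerSeries.coeff n E * (n.choose p.1 : k) =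
      PowerSeries.coeff p.1 E * PowerSeries.coeff p.2 E := by
    rintro n ⟨i, j⟩ hp
    rw [Finset.HasAntidiagonal.mem_antidiagonal] at hp
    subst hp
    have h1 : ((i + j).factorial : k) ≠ 0 := Nat.cast_ne_zero.2 (Nat.factorial_ne_zero _)
    have h2 : (i.factorial : k) ≠ 0 := Nat.cast_ne_zero.2 (Nat.factorial_ne_zero _)
    have h3 : (j.factorial : k) ≠ 0 := Nat.cast_ne_zero.2 (Nat.factorial_ne_zero _)
    have h4 : ((i + j).choose i : k) * i.factorial * j.factorial = (i + j).factorial := by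
      have := Nat.add_choose_mul_factorial_mul_factorial i j
      rw [← Nat.choose_symm_add] at this
      exact_mod_cast this
    simp only [hE, PowerSeries.coeff_rescale, PowerSeries.coeff_exp, map_div₀, map_one,
      map_natCast]
    field_simp
    rw [← h4]
    ring
  rw [ser_apply hx (Subalgebra.mul_mem _ hu hv) _ (show N ≤ N + N by omega) hz,
    Module.End.mul_apply, ser_apply hx hv E le_rfl hz, map_sum]
  have hR : ∀ j ∈ Finset.range N, ser x E u (PowerSeries.coeff j E • (ad x ^ j) v z) =
      ∑ i ∈ Finset.range N, (PowerSeries.coeff i E * PowerSeries.coeff j E) •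
        ((ad x ^ i) u) ((ad x ^ j) v z) := by
    intro j _
    rw [map_smul, ser_apply hx hu E le_rfl (ad_pow_mem_filtered hx hv j N z hz), Finset.smul_sum]
    refine Finset.sum_congr rfl fun i _ => ?_
    rw [smul_smul, mul_comm]
  rw [Finset.sum_congr rfl hR, Finset.sum_comm]
  have hL : ∀ n ∈ Finset.range (N + N), PowerSeries.coeff n E • (ad x ^ n) (u * v) z =
      ∑ p ∈ Finset.HasAntidiagonal.antidiagonal n, (PowerSeries.coeff p.1 E * PowerSeries.coeff p.2 E) •
        ((ad x ^ p.1) u) ((ad x ^ p.2) v z) := by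
    intro n _
    rw [ad_pow_mul, LinearMap.sum_apply, Finset.smul_sum]
    refine Finset.sum_congr rfl fun p hp => ?_
    rw [← hc n p hp, mul_smul, LinearMap.smul_apply, Nat.cast_smul_eq_nsmul]
    rfl
  rw [Finset.sum_congr rfl hL, ← Finset.sum_product', Finset.sum_sigma']
  have hz0 : ∀ i j, N ≤ i ∨ N ≤ j → ((ad x ^ i) u) ((ad x ^ j) v z) = 0 := by
    rintro i j (h | h)
    · exact ad_pow_eq_zero hx hu h (ad_pow_mem_filtered hx hv j N z hz)
    · rw [ad_pow_eq_zero hx hv h hz, map_zero]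
  symm
  refine Finset.sum_bij_ne_zero (fun p _ _ => ⟨p.1 + p.2, p⟩) ?_ ?_ ?_ ?_
  · intro p hp _
    simp at hp ⊢
    omega
  · rintro p _ _ q _ _ h
    exact eq_of_heq (Sigma.mk.inj h).2
  · rintro ⟨n, a, b⟩ hp h
    simp at hp
    refine ⟨(a, b), ?_, h, ?_⟩
    · simp only [Finset.mem_product, Finset.mem_range]
      by_contra hc
      apply h
      simp only
      rw [hz0 a b (by omega), smul_zero]
    · simp [hp.2]
  · intro p _ _
    rfl

end ser

end TBar

/-! ### Gauge action of the exponential -/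

namespace TBar

open Full

section gauge

variable (k : Type*) [Field k] [CharZero k]

/-- The power series `(exp (s z) - 1) / z`. -/
def expQuot (s : k) : PowerSeries k :=
  PowerSeries.mk fun n => s ^ (n + 1) * algebraMap ℚ k (1 / (n + 1).factorial)

/-- The power series `(exp (s z) - 1) / (exp z - 1)`. -/
def gaugeSeries (s : k) : PowerSeries k := bernoulliPowerSeries k * expQuot k s

variable {k}

lemma X_mul_expQuot (s : k) :
    PowerSeries.X * expQuot k s = PowerSeries.rescale s (PowerSeries.exp k) - 1 := by
  ext n
  cases n with
  | zero => rw [map_sub, PowerSeries.coeff_rescale]; simp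
  | succ n =>
    rw [PowerSeries.coeff_succ_X_mul, expQuot, PowerSeries.coeff_mk, map_sub,
      PowerSeries.coeff_rescale, PowerSeries.coeff_exp]
    simp [PowerSeries.coeff_one]

/-- In time one the flow reaches `τ` itself. Equivalently, the Bernoulli series is inverse to
`expQuot k 1`. -/
lemma gaugeSeries_one : gaugeSeries k 1 = 1 := by
  refine mul_left_cancel₀ (PowerSeries.X_ne_zero (R := k)) ?_
  rw [gaugeSeries, mul_left_comm, X_mul_expQuot, PowerSeries.rescale_one, RingHom.id_apply,
    bernoulliPowerSeries_mul_exp_sub_one, mul_one]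

lemma constantCoeff_bernoulli : PowerSeries.coeff 0 (bernoulliPowerSeries k) = 1 := by
  simp [bernoulliPowerSeries]

lemma coeff_zero_gaugeSeries (s : k) : PowerSeries.coeff 0 (gaugeSeries k s) = s := by
  rw [gaugeSeries, PowerSeries.coeff_mul, Finset.Nat.antidiagonal_zero, Finset.sum_singleton,
    constantCoeff_bernoulli, one_mul, expQuot, PowerSeries.coeff_mk]
  simp

/-- Both sides equal `(s' - s) z exp (s z) / (exp z - 1)`. This is the rule for `dt` on the piece of
the flow line from time `s` to time `s'`; it remains valid for `s = s'`. -/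
lemma bernoulli_rescale_mul (s s' : k) :
    PowerSeries.rescale (s' - s) (bernoulliPowerSeries k) * (gaugeSeries k s' - gaugeSeries k s) =
      PowerSeries.C (s' - s) * bernoulliPowerSeries k +
        PowerSeries.C (s' - s) * (PowerSeries.X * gaugeSeries k s) := by
  refine mul_left_cancel₀ (PowerSeries.X_ne_zero (R := k)) ?_
  have h1 := X_mul_expQuot s
  have h2 := X_mul_expQuot s'
  have h3 : PowerSeries.rescale s' (PowerSeries.exp k) =
      PowerSeries.rescale (s' - s) (PowerSeries.exp k) *
        PowerSeries.rescale s (PowerSeries.exp k) := by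
    rw [PowerSeries.exp_mul_exp_eq_exp_add, sub_add_cancel]
  have h4 := congrArg (PowerSeries.rescale (s' - s)) (bernoulliPowerSeries_mul_exp_sub_one k)
  rw [map_mul, map_sub, map_one, PowerSeries.rescale_X] at h4
  rw [h3] at h2
  -- After multiplication by `X`, only the defining relations of the exponential quotients and the
  -- rescaled Bernoulli relation are needed, so there is no division by `s' - s`.
  simp only [gaugeSeries]
  linear_combination (PowerSeries.rescale (s' - s) (bernoulliPowerSeries k) *
    bernoulliPowerSeries k) * (h2 - h1) + bernoulliPowerSeries k *
    PowerSeries.rescale s (PowerSeries.exp k) * h4 -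
      PowerSeries.C (s' - s) * PowerSeries.X * bernoulliPowerSeries k * h1

variable {ι : Type*}

/-- If `τ` is a Maurer–Cartan element for `d` which is gauge equivalent to zero by `x`, then all
elements obtained from zero by the flow of `x` are Maurer–Cartan elements. -/
lemma gauge_flow {x d τ : Module.End k (Full k ι)} (hx : Lowers x) (hd : d ∈ filtered k ι)
    (hτ : τ ∈ filtered k ι) (h1 : x * d - d * x = - ser x (bernoulliPowerSeries k) τ)
    (h2 : τ * d + d * τ = τ * τ) (s : k) :
    ser x (gaugeSeries k s) τ * d + d * ser x (gaugeSeries k s) τ =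
      ser x (gaugeSeries k s) τ * ser x (gaugeSeries k s) τ := by
  have hdd : d * d ∈ filtered k ι := Subalgebra.mul_mem _ hd hd
  have hE : ∀ s, ∀ y ∈ filtered k ι, ser x (PowerSeries.rescale s (PowerSeries.exp k)) y =
      y + ser x (expQuot k s) (x * y - y * x) := by
    intro s y hy
    rw [← ser_X hx hy, ← ser_mul hx hy, mul_comm, X_mul_expQuot, ser_sub_left hx hy,
      ser_one hx hy]
    abel
  -- The flow of `x` moves `d` to `d - ω_s`, by the hypothesis on the commutator of `x` and `d`.
  have hEd : ∀ s, ser x (PowerSeries.rescale s (PowerSeries.exp k)) d =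
      d - ser x (gaugeSeries k s) τ := by
    intro s
    rw [hE s d hd, h1, ser_neg_right hx (ser_mem_filtered hx hτ _), ← ser_mul hx hτ, gaugeSeries,
      mul_comm]
    abel
  have hsq : ∀ s, ser x (PowerSeries.rescale s (PowerSeries.exp k)) (d * d) =
      (d - ser x (gaugeSeries k s) τ) * (d - ser x (gaugeSeries k s) τ) := by
    intro s
    rw [ser_exp_mul hx s hd hd, hEd]
  -- At time one the hypothesis on `τ` says that the flow fixes `d * d`; it is not assumed that `d *
  -- d = 0`.
  have hone : ser x (expQuot k 1) (x * (d * d) - d * d * x) = 0 := by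
    have h := hsq 1
    rw [hE 1 _ hdd, gaugeSeries_one, ser_one hx hτ] at h
    have h3 : (d - τ) * (d - τ) = d * d := by
      have : (d - τ) * (d - τ) = d * d - (τ * d + d * τ) + τ * τ := by noncomm_ring
      rw [this, h2]
      abel
    rw [h3] at h
    exact add_eq_left.1 h
  -- The Bernoulli series inverts `expQuot k 1`, so `x` commutes with `d * d`. The flow therefore
  -- fixes `d * d` at every time.
  have hcomm : x * (d * d) - d * d * x = 0 := by
    have hm : x * (d * d) - d * d * x ∈ filtered k ι :=
      Subalgebra.sub_mem _ (Subalgebra.mul_mem _ hx.mem_filtered hdd)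
        (Subalgebra.mul_mem _ hdd hx.mem_filtered)
    have h := congrArg (ser x (bernoulliPowerSeries k)) hone
    rw [← ser_mul hx hm, ← gaugeSeries, gaugeSeries_one, ser_one hx hm] at h
    rw [h]
    refine LinearMap.ext fun z => ?_
    obtain ⟨N, hN⟩ := exists_mem_lenLT z
    rw [ser_apply hx (Subalgebra.zero_mem _) _ le_rfl hN]
    simp
  have h := hsq s
  rw [hE s _ hdd, hcomm] at h
  have h0 : ser x (expQuot k s) (0 : Module.End k (Full k ι)) = 0 := by
    refine LinearMap.ext fun z => ?_
    obtain ⟨N, hN⟩ := exists_mem_lenLT z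
    rw [ser_apply hx (Subalgebra.zero_mem _) _ le_rfl hN]
    simp
  rw [h0, add_zero] at h
  set ω := ser x (gaugeSeries k s) τ
  have h5 : (d - ω) * (d - ω) = d * d - (ω * d + d * ω) + ω * ω := by noncomm_ring
  rw [h5] at h
  have h6 : ω * d + d * ω = d * d - (d * d - (ω * d + d * ω) + ω * ω) + ω * ω := by abel
  rw [h6, ← h]
  abel

end gauge

/-! ### Properties inherited by power series in the commutator -/

section inherit

variable {k ι : Type*} [Field k] {x y : Module.End k (Full k ι)}

/-- On words of bounded length, a power series in the commutator with `x` applied to `y` agrees with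
a member of any given submodule that contains `y` and is stable under the commutator. -/
lemma exists_eq_ser (hx : Lowers x) (hy : y ∈ filtered k ι) (f : PowerSeries k)
    (P : Submodule k (Module.End k (Full k ι))) (hP : ∀ y ∈ P, x * y - y * x ∈ P) (hyP : y ∈ P)
    (N : ℕ) : ∃ D ∈ P, ∀ z ∈ lenLT k ι N, ser x f y z = D z := by
  have hn : ∀ n, (ad x ^ n) y ∈ P := by
    intro n
    induction n with
    | zero => exact hyP
    | succ n ih => rw [ad_pow_succ]; exact hP _ ih
  refine ⟨∑ n ∈ Finset.range N, PowerSeries.coeff n f • (ad x ^ n) y,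
    Submodule.sum_mem _ fun n _ => Submodule.smul_mem _ _ (hn n), fun z hz => ?_⟩
  rw [ser_apply hx hy f le_rfl hz, LinearMap.sum_apply]
  rfl

/-- Being colinear is tested on one element at a time, where the series is a finite sum of iterated
commutators. The next two lemmas use the same reduction. -/
lemma ser_mem_colinear (hx : Lowers x) (hy : y ∈ filtered k ι) (f : PowerSeries k)
    (hxc : x ∈ colinear k ι) (hyc : y ∈ colinear k ι) : ser x f y ∈ colinear k ι := by
  refine mem_colinear fun v z => ?_
  obtain ⟨N, hN⟩ := exists_mem_lenLT z
  obtain ⟨D, hD, h⟩ := exists_eq_ser hx hy f (Subalgebra.toSubmodule (colinear k ι))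
    (fun u hu => Subalgebra.sub_mem _ (Subalgebra.mul_mem _ hxc hu) (Subalgebra.mul_mem _ hu hxc))
    hyc N
  rw [h z hN, h _ (dropEnd_mem_filtered v N z hN), colinear_apply hD]

variable {deg : ι → ℤ}

lemma ser_mem_lowersDeg (hx : Lowers x) (hy : y ∈ filtered k ι) (f : PowerSeries k) {r : ℤ}
    (hxd : x ∈ lowersDeg deg 0) (hyd : y ∈ lowersDeg deg r) : ser x f y ∈ lowersDeg deg r := by
  intro n z hz
  obtain ⟨N, hN⟩ := exists_mem_lenLT z
  obtain ⟨D, hD, h⟩ := exists_eq_ser hx hy f (lowersDeg deg r)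
    (fun u hu => Submodule.sub_mem _ (by simpa using lowersDeg_mul hxd hu)
      (by simpa using lowersDeg_mul hu hxd)) hyd N
  rw [h z hN]
  exact hD n z hz

lemma ser_mem_skewDer (hx : Lowers x) (hy : y ∈ filtered k ι) (f : PowerSeries k) {r : ℤ}
    (hxs : x ∈ skewDer deg k 0) (hxd : x ∈ lowersDeg deg 0) (hys : y ∈ skewDer deg k r) :
    ser x f y ∈ skewDer deg k r := by
  intro a b
  obtain ⟨N₁, h₁⟩ := exists_mem_lenLT (shuffleF deg k a b)
  obtain ⟨N₂, h₂⟩ := exists_mem_lenLT a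
  obtain ⟨N₃, h₃⟩ := exists_mem_lenLT b
  obtain ⟨D, hD, h⟩ := exists_eq_ser hx hy f (skewDer deg k r)
    (fun u hu => commutator_mem_skewDer hxs hxd hu) hys (N₁ + N₂ + N₃)
  rw [h _ (lenLT_mono (by omega) h₁), h _ (lenLT_mono (by omega) h₂),
    h _ (lenLT_mono (by omega) h₃), hD]

/-- Operators intertwined by `F` remain so after forming power series in the commutator. -/
lemma ser_intertwine {x' y' F : Module.End k (Full k ι)} (hx : Lowers x) (hy : y ∈ filtered k ι)
    (hx' : Lowers x') (hy' : y' ∈ filtered k ι) (hF : F ∈ filtered k ι) (hxF : x * F = F * x')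
    (hyF : y * F = F * y') (f : PowerSeries k) : ser x f y * F = F * ser x' f y' := by
  have hn : ∀ n, (ad x ^ n) y * F = F * (ad x' ^ n) y' := by
    intro n
    induction n with
    | zero => exact hyF
    | succ n ih =>
      rw [ad_pow_succ, ad_pow_succ, sub_mul, mul_sub, mul_assoc, ih, mul_assoc, hxF,
        ← mul_assoc, hxF, ← mul_assoc, ih]
      simp only [mul_assoc]
  refine ser_ext fun N z hz => ?_
  rw [Module.End.mul_apply, Module.End.mul_apply, ser_apply hx hy f le_rfl (hF N z hz),
    ser_apply hx' hy' f le_rfl hz, map_sum]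
  refine Finset.sum_congr rfl fun n _ => ?_
  rw [map_smul, ← Module.End.mul_apply, hn, Module.End.mul_apply]

end inherit

end TBar

/-! ### Commutation with a coderivation, and expansion of iterated commutators -/

namespace TBar

open Full

/-- The endomorphism with twisted word derivatives `D` commutes with a coderivation as soon as the
commutation rules of the coderivation with the twisted and with the ordinary word derivatives
match. -/
lemma cofree_coderF {k ι : Type*} [Field k] [Finite ι] {deg : ι → ℤ} {m : List ι → (ι →₀ k)}
    {D Q Q' : ι → Module.End k (Full k ι)} (hD : ∀ j, Lowers (D j))
    (hQ : ∀ j, del k j * coderF deg m = Q j + sgn k (deg j) • (coderF deg m * del k j))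
    (hQ' : ∀ j, D j * coderF deg m = Q' j + sgn k (deg j) • (coderF deg m * D j))
    (hi : ∀ j, Q j * cofree D hD = cofree D hD * Q' j) (z : Full k ι) :
    cofree D hD (coderF deg m z) = coderF deg m (cofree D hD z) := by
  obtain ⟨N, hN⟩ := exists_mem_lenLT z
  induction N generalizing z with
  | zero => rw [eq_zero_of_mem_lenLT_zero hN]; simp
  | succ N ih =>
    -- Both sides have zero counit; their derivatives agree by the matching rules and by induction
    -- applied to the shorter element `D j z`.
    refine ext_del ?_ fun j => ?_
    · rw [cofree_nil, coderF_nil, coderF_nil]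
    · have h1 := LinearMap.congr_fun (hQ j) (cofree D hD z)
      have h2 := LinearMap.congr_fun (hQ' j) z
      have h3 := LinearMap.congr_fun (hi j) z
      simp only [Module.End.mul_apply, LinearMap.add_apply, LinearMap.smul_apply] at h1 h2 h3
      rw [del_cofree, h2, h1, map_add, map_smul, h3, ih _ (hD j N z hN), del_cofree]

lemma del_pow_apply {k ι : Type*} [Field k] (j : ι) (n : ℕ) (x : Full k ι) (v : List ι) :
    (del k j ^ n) x v = x (List.replicate n j ++ v) := by
  induction n generalizing x with
  | zero => rfl
  | succ n ih => rw [pow_succ, Module.End.mul_apply, ih, del_apply]; rfl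

/-- Left and right multiplication by `x` commute, so the binomial theorem applies to their
difference. -/
lemma ad_pow_eq_sum {k ι : Type*} [Field k] (x y : Module.End k (Full k ι)) (n : ℕ) :
    (ad x ^ n) y = ∑ p ∈ Finset.HasAntidiagonal.antidiagonal n,
      ((-1) ^ p.1 * (n.choose p.1 : k)) • (x ^ p.2 * y * x ^ p.1) := by
  have hc : Commute (-LinearMap.mulRight k x) (LinearMap.mulLeft k x) :=
    (LinearMap.commute_mulLeft_right (R := k) x x).symm.neg_left
  rw [ad, sub_eq_neg_add, hc.add_pow', LinearMap.sum_apply]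
  refine Finset.sum_congr rfl fun p _ => ?_
  have hs : (-LinearMap.mulRight k x) ^ p.1 = (-1 : k) ^ p.1 • LinearMap.mulRight k (x ^ p.1) := by
    rw [← LinearMap.pow_mulRight, ← _root_.smul_pow, neg_one_smul]
  rw [hs, LinearMap.pow_mulLeft, ← Nat.cast_smul_eq_nsmul k, smul_mul_assoc, smul_smul, mul_comm,
    LinearMap.smul_apply, Module.End.mul_apply, LinearMap.mulRight_apply, LinearMap.mulLeft_apply]

end TBar

/-! ### Taylor coefficients of the Whitney forms as power series in commutators -/

namespace Whitney

open TBar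

/-- The rightmost factors act first, so `p.1` counts the letters `dt` in front of `t` and `p.2`
those behind it. -/
lemma del_ad_pow_nil {k : Type*} [Field k] (n : ℕ) (z : Full k Letter) :
    (ad (del k Letter.dt) ^ n) (del k Letter.t) z [] =
      ∑ p ∈ Finset.HasAntidiagonal.antidiagonal n, (-1) ^ p.1 * (n.choose p.1 : k) *
        z (List.replicate p.1 Letter.dt ++ Letter.t :: List.replicate p.2 Letter.dt) := by
  rw [ad_pow_eq_sum, LinearMap.sum_apply, Full.sum_apply]
  refine Finset.sum_congr rfl fun p _ => ?_
  rw [LinearMap.smul_apply, Full.smul_apply, Module.End.mul_apply, Module.End.mul_apply,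
    del_pow_apply, del_apply, del_pow_apply, List.append_nil]

section

variable {k : Type*} [Field k]

lemma replicate_append_inj {i j i' j' : ℕ}
    (h : List.replicate i Letter.dt ++ Letter.t :: List.replicate j Letter.dt =
      List.replicate i' Letter.dt ++ Letter.t :: List.replicate j' Letter.dt) :
    i = i' ∧ j = j' := by
  have h1 : ∀ a b, (List.replicate a Letter.dt ++ Letter.t :: List.replicate b Letter.dt).idxOf
      Letter.t = a := by
    intro a b
    rw [List.idxOf_append_of_notMem (by simp)]
    simp
  have h2 := congrArg (List.idxOf Letter.t) h
  rw [h1, h1] at h2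
  have h3 := congrArg List.length h
  simp at h3
  omega

lemma eq_replicate_append {w : List Letter} (h1 : Letter.one ∉ w) (h2 : w.count Letter.t = 1) :
    w = List.replicate (w.idxOf Letter.t) Letter.dt ++
      Letter.t :: List.replicate (w.length - 1 - w.idxOf Letter.t) Letter.dt := by
  induction w with
  | nil => simp at h2
  | cons a w ih =>
    rw [List.mem_cons, not_or] at h1
    cases a with
    | one => exact absurd rfl h1.1
    | t =>
      rw [List.count_cons_self, Nat.add_eq_right] at h2
      have : w = List.replicate w.length Letter.dt := by
        refine List.eq_replicate_iff.2 ⟨rfl, fun b hb => ?_⟩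
        cases b with
        | one => exact absurd hb h1.2
        | t => exact absurd hb (List.count_eq_zero.1 h2)
        | dt => rfl
      simpa using this
    | dt =>
      rw [List.count_cons_of_ne (by simp)] at h2
      have := ih h1.2 h2
      rw [List.idxOf_cons_ne _ (by simp), List.replicate_succ, List.cons_append]
      conv_lhs => rw [this]
      have hlt : w.idxOf Letter.t < w.length :=
        List.idxOf_lt_length_of_mem (List.count_pos_iff.1 (by omega))
      simp only [List.length_cons, Nat.add_sub_cancel]
      congr 4
      omega

lemma del_lowers_dt : Lowers (del k Letter.dt) := del_lowers _

lemma ser_wd_replicate (f : PowerSeries k) (i j : ℕ) :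
    ser (del k Letter.dt) f (del k Letter.t)
      (wd k (List.replicate i Letter.dt ++ Letter.t :: List.replicate j Letter.dt)) [] =
      PowerSeries.coeff (i + j) f * ((-1) ^ i * ((i + j).choose i : k)) := by
  rw [ser_apply del_lowers_dt (del_lowers _).mem_filtered f le_rfl
    (wd_mem_lenLT (Nat.lt_succ_self _)), Full.sum_apply, Finset.sum_eq_single (i + j)]
  · rw [Full.smul_apply, del_ad_pow_nil, Finset.sum_eq_single (i, j)]
    · simp [wd_apply]
    · intro p _ hp
      rw [wd_apply, if_neg, mul_zero]
      intro h
      obtain ⟨h1, h2⟩ := replicate_append_inj h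
      exact hp (Prod.ext h1.symm h2.symm)
    · simp
  · intro n _ hn
    rw [Full.smul_apply, del_ad_pow_nil, Finset.sum_eq_zero, mul_zero]
    intro p hp
    rw [wd_apply, if_neg, mul_zero]
    intro h
    obtain ⟨h1, h2⟩ := replicate_append_inj h
    rw [Finset.HasAntidiagonal.mem_antidiagonal] at hp
    omega
  · intro h
    simp at h

lemma ser_wd_of_not {w : List Letter} (h : ¬ (Letter.one ∉ w ∧ w.count Letter.t = 1))
    (f : PowerSeries k) : ser (del k Letter.dt) f (del k Letter.t) (wd k w) [] = 0 := by
  rw [ser_apply del_lowers_dt (del_lowers _).mem_filtered f le_rfl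
    (wd_mem_lenLT (Nat.lt_succ_self _)), Full.sum_apply]
  refine Finset.sum_eq_zero fun n _ => ?_
  rw [Full.smul_apply, del_ad_pow_nil, Finset.sum_eq_zero, mul_zero]
  intro p _
  rw [wd_apply, if_neg, mul_zero]
  rintro rfl
  exact h (by simp [List.count_replicate])

/-- The binomial coefficients and alternating signs of the structure maps are those of an iterated
commutator; only the coefficients of `f` remain to be chosen. -/
lemma ser_wd (f : PowerSeries k) (w : List Letter) :
    ser (del k Letter.dt) f (del k Letter.t) (wd k w) [] =
      if Letter.one ∉ w ∧ w.count Letter.t = 1 then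
        PowerSeries.coeff (w.length - 1) f *
          ((-1) ^ w.idxOf Letter.t * ((w.length - 1).choose (w.idxOf Letter.t) : k))
      else 0 := by
  split_ifs with h
  · have hlt : w.idxOf Letter.t < w.length :=
      List.idxOf_lt_length_of_mem (List.count_pos_iff.1 (by omega))
    have h1 := ser_wd_replicate f (w.idxOf Letter.t) (w.length - 1 - w.idxOf Letter.t)
    rw [← eq_replicate_append h.1 h.2,
      show w.idxOf Letter.t + (w.length - 1 - w.idxOf Letter.t) = w.length - 1 by omega] at h1
    exact h1
  · exact ser_wd_of_not h f

/-- The special clauses of the definition concern words of length at most two, so here only the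
general clause applies. -/
lemma taylor_cons_cons_cons (a b c : Letter) (w : List Letter) :
    taylor k (a :: b :: c :: w) =
      if Letter.one ∉ (a :: b :: c :: w) ∧ (a :: b :: c :: w).count Letter.t = 1 then
        Finsupp.single .dt
          ((-1) ^ ((a :: b :: c :: w).idxOf Letter.t + 1) *
            (((a :: b :: c :: w).length - 1).choose ((a :: b :: c :: w).idxOf Letter.t) : k) *
            ((_root_.bernoulli ((a :: b :: c :: w).length - 1) : ℚ) : k) /
              (((a :: b :: c :: w).length - 1).factorial : k))
      else 0 := by
  cases a <;> cases b <;> rfl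

lemma taylor_one (w : List Letter) :
    taylor k w Letter.one = if w = [Letter.one, Letter.one] then 1 else 0 := by
  rcases w with _ | ⟨a, _ | ⟨b, _ | ⟨c, w⟩⟩⟩
  · simp [taylor]
  · cases a <;> simp [taylor]
  · cases a <;> cases b <;> simp [taylor]
  · rw [taylor_cons_cons_cons]
    split_ifs <;> simp_all

lemma taylor_t (w : List Letter) :
    taylor k w Letter.t = (if w = [Letter.one, Letter.t] then 1 else 0) +
      (if w = [Letter.t, Letter.one] then 1 else 0) +
        (if w = [Letter.t, Letter.t] then 1 else 0) := by
  rcases w with _ | ⟨a, _ | ⟨b, _ | ⟨c, w⟩⟩⟩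
  · simp [taylor]
  · cases a <;> simp [taylor]
  · cases a <;> cases b <;> simp [taylor]
  · rw [taylor_cons_cons_cons]
    split_ifs <;> simp_all

variable [CharZero k]

lemma coeff_bernoulli (n : ℕ) : PowerSeries.coeff n (bernoulliPowerSeries k) =
    ((_root_.bernoulli n : ℚ) : k) / (n.factorial : k) := by
  simp [bernoulliPowerSeries]

/-- All operations with one argument `t`, the others being `dt`, are packed into a single Bernoulli
series in `ad (del dt)`, including `m₁` as its constant term. -/
lemma taylor_dt (w : List Letter) :
    taylor k w Letter.dt = (if w = [Letter.one, Letter.dt] then 1 else 0) -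
      (if w = [Letter.dt, Letter.one] then 1 else 0) -
        ser (del k Letter.dt) (bernoulliPowerSeries k) (del k Letter.t) (wd k w) [] := by
  rw [ser_wd, coeff_bernoulli]
  rcases w with _ | ⟨a, _ | ⟨b, _ | ⟨c, w⟩⟩⟩
  · simp [taylor]
  · cases a <;> simp [taylor]
  · cases a <;> cases b <;> simp [taylor, pow_succ]
  · rw [taylor_cons_cons_cons]
    split_ifs <;> simp_all [pow_succ]
    ring

end

end Whitney

/-! ### The morphism with prescribed linear part -/

namespace Whitney

open TBar

variable {k : Type*} [Field k]

lemma del_filtered (j : Letter) : del k j ∈ filtered k Letter := (del_lowers j).mem_filtered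

/-- The product of two derivatives detects the word with the letters in the opposite order. -/
lemma del_del_wd_nil (i j : Letter) (w : List Letter) :
    (del k i * del k j) (wd k w) [] = if w = [j, i] then 1 else 0 := by
  rw [Module.End.mul_apply, del_apply, del_apply, wd_apply]

lemma sub_apply_nil (D E : Module.End k (Full k Letter)) (z : Full k Letter) :
    (D - E) z [] = D z [] - E z [] := by
  rw [LinearMap.sub_apply, sub_eq_add_neg, ← neg_one_smul k (E z), Full.add_apply,
    Full.smul_apply, neg_one_mul, sub_eq_add_neg]

lemma sgn_neg_one : sgn k (-1) = -1 := by simp [sgn]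

variable (k) in
/-- The coderivation of the Whitney forms on the full tensor coalgebra. -/
def codiff : Module.End k (Full k Letter) := coderF sdeg (taylor k)

lemma codiff_filtered : codiff k ∈ filtered k Letter := coderF_mem_filtered _ _

variable (k) [CharZero k]

/-- The flow of the letter `dt` applied to the letter `t`, for time `s`. -/
def flow (s : k) : Module.End k (Full k Letter) :=
  ser (del k Letter.dt) (gaugeSeries k s) (del k Letter.t)

/-- The operators by which the codifferential fails to commute with the word
derivatives. -/
def failure : Letter → Module.End k (Full k Letter)
  | .one => del k .one * del k .one
  | .t => del k .one * del k .t + del k .t * del k .one + del k .t * del k .t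
  | .dt => del k .dt * del k .one - del k .one * del k .dt -
      ser (del k .dt) (bernoulliPowerSeries k) (del k .t)

/-- The twisted word derivatives of the morphism with linear part
`t ↦ (s' - s) t + s`, `dt ↦ (s' - s) dt`. -/
def twisted (s s' : k) : Letter → Module.End k (Full k Letter)
  | .one => del k .one + flow k s
  | .t => flow k s' - flow k s
  | .dt => (s' - s) • del k .dt

/-- The analogue of `failure` for the twisted word derivatives. -/
def twistedFailure (s s' : k) : Letter → Module.End k (Full k Letter)
  | .one => twisted k s s' .one * twisted k s s' .one
  | .t => twisted k s s' .one * twisted k s s' .t + twisted k s s' .t * twisted k s s' .one +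
      twisted k s s' .t * twisted k s s' .t
  | .dt => twisted k s s' .dt * twisted k s s' .one - twisted k s s' .one * twisted k s s' .dt -
      ser (twisted k s s' .dt) (bernoulliPowerSeries k) (twisted k s s' .t)

variable {k}

lemma flow_lowers (s : k) : Lowers (flow k s) := ser_lowers (del_lowers _) (del_lowers _) _

lemma twisted_lowers (s s' : k) (j : Letter) : Lowers (twisted k s s' j) := by
  cases j
  · exact (del_lowers _).add (flow_lowers s)
  · exact (flow_lowers s').sub (flow_lowers s)
  · exact (del_lowers _).smul _

lemma flow_colinear (s : k) : flow k s ∈ colinear k Letter :=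
  ser_mem_colinear (del_lowers _) (del_filtered _) _ (del_mem_colinear _) (del_mem_colinear _)

lemma twisted_colinear (s s' : k) (j : Letter) : twisted k s s' j ∈ colinear k Letter := by
  cases j
  · exact Subalgebra.add_mem _ (del_mem_colinear _) (flow_colinear s)
  · exact Subalgebra.sub_mem _ (flow_colinear s') (flow_colinear s)
  · exact Subalgebra.smul_mem _ (del_mem_colinear _) _

lemma flow_lowersDeg (s : k) : flow k s ∈ lowersDeg sdeg (-1) :=
  ser_mem_lowersDeg (del_lowers _) (del_filtered _) _ (del_mem_lowersDeg Letter.dt)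
    (del_mem_lowersDeg Letter.t)

lemma twisted_lowersDeg (s s' : k) (j : Letter) : twisted k s s' j ∈ lowersDeg sdeg (sdeg j) := by
  cases j
  · exact Submodule.add_mem _ (del_mem_lowersDeg Letter.one) (flow_lowersDeg s)
  · exact Submodule.sub_mem _ (flow_lowersDeg s') (flow_lowersDeg s)
  · exact Submodule.smul_mem _ _ (del_mem_lowersDeg Letter.dt)

lemma flow_skewDer (s : k) : flow k s ∈ skewDer sdeg k (-1) :=
  ser_mem_skewDer (del_lowers _) (del_filtered _) _ (del_mem_skewDer Letter.dt)
    (del_mem_lowersDeg Letter.dt) (del_mem_skewDer Letter.t)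

lemma twisted_skewDer (s s' : k) (j : Letter) : twisted k s s' j ∈ skewDer sdeg k (sdeg j) := by
  cases j
  · exact Submodule.add_mem _ (del_mem_skewDer Letter.one) (flow_skewDer s)
  · exact Submodule.sub_mem _ (flow_skewDer s') (flow_skewDer s)
  · exact Submodule.smul_mem _ _ (del_mem_skewDer Letter.dt)

lemma failure_colinear (j : Letter) : failure k j ∈ colinear k Letter := by
  have hm : ∀ i j, del k i * del k j ∈ colinear k Letter := fun i j =>
    Subalgebra.mul_mem _ (del_mem_colinear i) (del_mem_colinear j)
  cases j
  · exact hm _ _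
  · exact Subalgebra.add_mem _ (Subalgebra.add_mem _ (hm _ _) (hm _ _)) (hm _ _)
  · exact Subalgebra.sub_mem _ (Subalgebra.sub_mem _ (hm _ _) (hm _ _))
      (ser_mem_colinear (del_lowers _) (del_filtered _) _ (del_mem_colinear _)
        (del_mem_colinear _))

lemma failure_wd (j : Letter) (w : List Letter) : failure k j (wd k w) [] = taylor k w j := by
  cases j
  · rw [taylor_one, failure, del_del_wd_nil]
  · rw [taylor_t, failure, LinearMap.add_apply, LinearMap.add_apply, Full.add_apply,
      Full.add_apply, del_del_wd_nil, del_del_wd_nil, del_del_wd_nil]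
    ring
  · rw [taylor_dt, failure, sub_apply_nil, sub_apply_nil, del_del_wd_nil, del_del_wd_nil]

lemma del_mul_codiff (j : Letter) :
    del k j * codiff k = failure k j + sgn k (sdeg j) • (codiff k * del k j) :=
  del_mul_coderF rfl (failure_colinear j) fun w => failure_wd j w

lemma one_mul_codiff : del k .one * codiff k + codiff k * del k .one =
    del k .one * del k .one := by
  have h := del_mul_codiff (k := k) .one
  simp only [sdeg, sgn_neg_one, neg_smul, one_smul, failure] at h
  rw [h]
  abel

lemma t_mul_codiff : del k .t * codiff k + codiff k * del k .t =
    del k .one * del k .t + del k .t * del k .one + del k .t * del k .t := by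
  have h := del_mul_codiff (k := k) .t
  simp only [sdeg, sgn_neg_one, neg_smul, one_smul, failure] at h
  rw [h]
  abel

lemma dt_mul_codiff : del k .dt * codiff k - codiff k * del k .dt =
    del k .dt * del k .one - del k .one * del k .dt -
      ser (del k .dt) (bernoulliPowerSeries k) (del k .t) := by
  have h := del_mul_codiff (k := k) .dt
  simp only [sdeg, sgn_zero, one_smul, failure] at h
  rw [h]
  abel

/-- Subtracting `del one` from the codifferential removes the unit terms from the rules for `t` and
`dt`, which turns them into the hypotheses of `gauge_flow`. -/
lemma flow_mul_codiff (s : k) : flow k s * codiff k + codiff k * flow k s =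
    del k .one * flow k s + flow k s * del k .one + flow k s * flow k s := by
  have h := gauge_flow (x := del k Letter.dt) (d := codiff k - del k .one) (τ := del k Letter.t)
    (del_lowers _) (Subalgebra.sub_mem _ codiff_filtered (del_filtered _)) (del_filtered _)
    (by
      rw [mul_sub, sub_mul]
      have := dt_mul_codiff (k := k)
      rw [sub_eq_iff_eq_add] at this
      rw [this]
      abel)
    (by
      rw [mul_sub, sub_mul]
      have := t_mul_codiff (k := k)
      rw [← eq_sub_iff_add_eq] at this
      rw [this]
      abel) s
  rw [← flow, mul_sub, sub_mul] at h
  rw [← h]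
  abel

/-- For `one` and `t` the rules say that both endpoints, `del one + ω_s` and `del one + ω_{s'}`, are
Maurer–Cartan. The rule for `dt` is the series identity `bernoulli_rescale_mul`. -/
lemma twisted_mul_codiff (s s' : k) (j : Letter) : twisted k s s' j * codiff k =
    twistedFailure k s s' j + sgn k (sdeg j) • (codiff k * twisted k s s' j) := by
  have ho := eq_sub_iff_add_eq.2 (one_mul_codiff (k := k))
  have hf := fun s : k => eq_sub_iff_add_eq.2 (flow_mul_codiff s)
  cases j
  · simp only [sdeg, sgn_neg_one, neg_smul, one_smul, twistedFailure, twisted]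
    rw [add_mul, ho, hf]
    noncomm_ring
  · simp only [sdeg, sgn_neg_one, neg_smul, one_smul, twistedFailure, twisted]
    rw [sub_mul, hf, hf]
    noncomm_ring
  · simp only [sdeg, sgn_zero, one_smul, twistedFailure, twisted]
    have hx : Lowers (del k Letter.dt) := del_lowers _
    have hτ : del k Letter.t ∈ filtered k Letter := del_filtered _
    have hd := sub_eq_iff_eq_add.1 (dt_mul_codiff (k := k))
    have h1 : ser (del k Letter.dt) (PowerSeries.rescale (s' - s) (bernoulliPowerSeries k))
        (flow k s' - flow k s) = (s' - s) • ser (del k Letter.dt) (bernoulliPowerSeries k)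
          (del k Letter.t) + (s' - s) • (del k .dt * flow k s - flow k s * del k .dt) := by
      rw [flow, flow, ← ser_sub_left hx hτ, ← ser_mul hx hτ, bernoulli_rescale_mul,
        ser_add_left hx hτ, ser_C_mul hx hτ, ser_C_mul hx hτ, ser_mul hx hτ,
        ser_X hx (ser_mem_filtered hx hτ _)]
    rw [ser_smul hx ((flow_lowers s').sub (flow_lowers s)).mem_filtered, h1]
    simp only [smul_mul_assoc, mul_smul_comm, ← smul_sub, ← smul_add]
    rw [hd]
    congr 1
    noncomm_ring

/-- The operators in `failure` are built from the `del j` by products and a commutator series, so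
the intertwining relation substitutes `twisted` for `del` throughout. -/
lemma failure_cofree (s s' : k) (j : Letter) :
    failure k j * cofree (twisted k s s') (twisted_lowers s s') =
      cofree (twisted k s s') (twisted_lowers s s') * twistedFailure k s s' j := by
  set F := cofree (twisted k s s') (twisted_lowers s s') with hF
  have h1 : ∀ j, del k j * F = F * twisted k s s' j := fun j => LinearMap.ext fun z =>
    del_cofree (twisted_lowers s s') j z
  have h2 : ∀ i j, del k i * del k j * F = F * (twisted k s s' i * twisted k s s' j) := by
    intro i j
    rw [mul_assoc, h1, ← mul_assoc, h1, mul_assoc]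
  cases j
  · exact h2 _ _
  · simp only [failure, twistedFailure, add_mul, mul_add, h2]
  · rw [failure, twistedFailure, sub_mul, sub_mul, mul_sub, mul_sub, h2, h2,
      ser_intertwine (del_lowers _) (del_filtered _) (twisted_lowers s s' .dt)
        (twisted_lowers s s' .t).mem_filtered (cofree_mem_filtered _) (h1 _) (h1 _)]

variable (k) in
/-- The unital morphism with linear part `t ↦ (s' - s) t + s`, `dt ↦ (s' - s) dt`. -/
def affineMorphism (s s' : k) : Module.End k (T k Letter) :=
  cofreeRed (twisted k s s') (twisted_lowers s s')

lemma affineMorphism_proj (s s' : k) (w : List Letter) (j : Letter) :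
    proj k Letter (affineMorphism k s s' (word k w)) j = twisted k s s' j (wd k w) [] := by
  rw [proj_apply, affineMorphism, cofreeRed_word_apply]
  rfl

/-- The flow is a series in `del dt` and `del t` alone and does not see words containing `one`; this
gives strict unitality. -/
lemma twisted_wd_of_mem (s s' : k) {w : List Letter} (h : Letter.one ∈ w) (j : Letter) :
    twisted k s s' j (wd k w) [] = if w = [Letter.one] ∧ j = Letter.one then 1 else 0 := by
  have hf : ∀ s : k, flow k s (wd k w) [] = 0 := fun s => ser_wd_of_not (fun hc => hc.1 h) _
  cases j
  · rw [twisted, LinearMap.add_apply, Full.add_apply, hf, del_apply, wd_apply]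
    simp
  · rw [twisted, sub_apply_nil, hf, hf]
    simp
  · rw [twisted, LinearMap.smul_apply, Full.smul_apply, del_apply, wd_apply, if_neg]
    · simp
    · rintro rfl
      simp at h

/-- Each axiom is one property of the twisted derivatives: homogeneity, colinearity, the skew
Leibniz rule, the commutation rules with the codifferential, and insensitivity of the flow to the
unit. -/
lemma affineMorphism_isUnitalCInf (s s' : k) :
    IsUnitalCInf sdeg (taylor k) Letter.one (affineMorphism k s s') where
  degree w v h := by
    rw [affineMorphism, cofreeRed_word_apply] at h
    exact cofree_wd_degree _ (twisted_lowersDeg s s') h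
  comul := cofreeRed_comul _ (twisted_colinear s s')
  shuffle x y := by
    apply emb_injective
    rw [affineMorphism, emb_cofreeRed, emb_shuffle, emb_shuffle, emb_cofreeRed, emb_cofreeRed,
      shuffle_cofree _ (twisted_lowersDeg s s') (twisted_skewDer s s')]
  coder x := by
    apply emb_injective
    rw [affineMorphism, emb_cofreeRed, emb_coder, emb_coder, emb_cofreeRed]
    exact cofree_coderF _ del_mul_codiff (twisted_mul_codiff s s') (failure_cofree s s') _
  unit_one := by
    ext j
    rw [affineMorphism_proj, twisted_wd_of_mem s s' (by simp), Finsupp.single_apply]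
    simp [eq_comm]
  unit_zero w hw h := by
    ext j
    rw [affineMorphism_proj, twisted_wd_of_mem s s' h, if_neg]
    · rfl
    · rintro ⟨rfl, -⟩
      simp at hw

lemma flow_wd_singleton (s : k) (j : Letter) :
    flow k s (wd k [j]) [] = if j = Letter.t then s else 0 := by
  rw [flow, ser_wd]
  cases j <;> simp [coeff_zero_gaugeSeries]

lemma affineMorphism_proj_t (s s' : k) :
    proj k Letter (affineMorphism k s s' (word k [Letter.t])) =
      Finsupp.single Letter.t (s' - s) + Finsupp.single Letter.one s := by
  ext j
  rw [affineMorphism_proj]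
  cases j
  · simp [twisted, flow_wd_singleton, del_apply, wd_apply]
  · rw [twisted, sub_apply_nil]
    simp [flow_wd_singleton]
  · simp [twisted, del_apply, wd_apply]

end Whitney

/-! ### Uniqueness of a morphism with given linear part -/

namespace TBar

variable {k ι : Type*} [Field k]

/-- A coalgebra endomorphism is determined on a word, except for its Taylor coefficient, by its
values on shorter words. -/
lemma apply_cons_eq_of_comul {F F' : Module.End k (T k ι)}
    (hF : ∀ x, comul k ι (F x) = TensorProduct.map F F (comul k ι x))
    (hF' : ∀ x, comul k ι (F' x) = TensorProduct.map F' F' (comul k ι x)) {w : List ι}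
    (h : ∀ v : List ι, v.length < w.length → F (word k v) = F' (word k v)) (hw : w ≠ []) (j : ι)
    (v : {v : List ι // v ≠ []}) :
    F (word k w) ⟨j :: v.1, by simp⟩ = F' (word k w) ⟨j :: v.1, by simp⟩ := by
  rw [← coeff_comul j v, ← coeff_comul j v, hF, hF', comul, lift_word _ hw]
  simp only [map_sum, TensorProduct.map_tmul]
  refine Finset.sum_congr rfl fun i hi => ?_
  rw [Finset.mem_range] at hi
  rcases Nat.eq_zero_or_pos i with rfl | h0
  · simp [word_nil]
  · rw [h _ (by rw [List.length_take]; omega), h _ (by rw [List.length_drop]; omega)]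

/-- By the Leibniz rule for `del j`, each term of this coefficient contains the coefficient of the
empty word in `x` or `y`, which is zero in the reduced coalgebra. -/
lemma shuffle_apply_singleton (deg : ι → ℤ) (x y : T k ι) (j : ι) :
    shuffle k deg x y ⟨[j], by simp⟩ = 0 := by
  classical
  rw [← emb_apply]
  change emb k ι (shuffle k deg x y) [j] = 0
  rw [emb_shuffle]
  have h := del_mem_skewDer (k := k) (deg := deg) j (emb k ι x) (emb k ι y)
  have h1 := DFunLike.congr_fun h []
  rw [del_apply] at h1
  rw [h1, Full.add_apply, shuffleF_apply_nil, shuffleF_apply_nil, emb_nil, mul_zero,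
    signOp_apply, emb_nil, mul_zero, zero_mul, add_zero]

end TBar

namespace Whitney

open TBar

variable {k : Type*} [Field k]

lemma shuffleWord_dt_cons (b : Letter) (v : List Letter) :
    shuffleWord k sdeg [Letter.dt] (b :: v) =
      word k (Letter.dt :: b :: v) + cons k b (shuffleWord k sdeg [Letter.dt] v) := by
  have h : wdeg sdeg [Letter.dt] = 0 := rfl
  rw [shuffleWord, shuffleWord, cons_word (by simp), h, mul_zero, sgn_zero, one_smul]

lemma shuffleWord_dt_replicate (n : ℕ) :
    shuffleWord k sdeg [Letter.dt] (List.replicate n Letter.dt) =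
      (n + 1 : k) • word k (List.replicate (n + 1) Letter.dt) := by
  induction n with
  | zero => simp [shuffleWord]
  | succ n ih =>
    rw [List.replicate_succ, shuffleWord_dt_cons, ih, map_smul, cons_word (by simp),
      ← List.replicate_succ, ← List.replicate_succ]
    push_cast
    rw [add_smul ((n : k) + 1), one_smul, add_comm]

/-- The new `dt` has degree zero, so no signs occur and the coefficients count the insertion places
before and after `t`. -/
lemma shuffleWord_dt_replicate_append (i m : ℕ) :
    shuffleWord k sdeg [Letter.dt]
      (List.replicate i Letter.dt ++ Letter.t :: List.replicate m Letter.dt) =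
      (i + 1 : k) •
        word k (List.replicate (i + 1) Letter.dt ++ Letter.t :: List.replicate m Letter.dt) +
      (m + 1 : k) •
        word k (List.replicate i Letter.dt ++ Letter.t :: List.replicate (m + 1) Letter.dt) := by
  induction i with
  | zero =>
    rw [List.replicate_zero, List.nil_append, shuffleWord_dt_cons, shuffleWord_dt_replicate,
      map_smul, cons_word (by simp)]
    simp
  | succ i ih =>
    rw [List.replicate_succ, List.cons_append, shuffleWord_dt_cons, ih, map_add, map_smul,
      map_smul, cons_word (by simp), cons_word (by simp), ← add_assoc]
    congr 1
    simp only [List.replicate_succ, List.cons_append]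
    push_cast
    rw [add_smul ((i : k) + 1), one_smul, add_comm]

lemma wdeg_eq_of_not_mem {w : List Letter} (h : Letter.one ∉ w) :
    wdeg sdeg w = - (w.count Letter.t : ℤ) := by
  induction w with
  | nil => rfl
  | cons a w ih =>
    rw [List.mem_cons, not_or] at h
    rw [wdeg_cons, ih h.2]
    cases a with
    | one => exact absurd rfl h.1
    | t => rw [List.count_cons_self]; simp [sdeg]
    | dt => rw [List.count_cons_of_ne (by simp)]; simp [sdeg]

lemma eq_replicate_of_count {w : List Letter} (h : Letter.one ∉ w) (h' : w.count Letter.t = 0) :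
    w = List.replicate w.length Letter.dt := by
  refine List.eq_replicate_iff.2 ⟨rfl, fun b hb => ?_⟩
  cases b with
  | one => exact absurd hb h
  | t => exact absurd hb (List.count_eq_zero.1 h')
  | dt => rfl

lemma taylor_replicate (n : ℕ) : taylor k (List.replicate n Letter.dt) = 0 := by
  rcases n with _ | _ | _ | n
  · rfl
  · rfl
  · simp [taylor, List.replicate]
  · rw [List.replicate_succ, List.replicate_succ, List.replicate_succ, taylor_cons_cons_cons,
      if_neg]
    simp [List.count_replicate]

lemma coder_replicate (n : ℕ) :
    coder sdeg (taylor k) (word k (List.replicate n Letter.dt)) = 0 := by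
  induction n with
  | zero => simp [word_nil]
  | succ n ih =>
    rw [List.replicate_succ, coder_word_cons, ih, map_zero, smul_zero, add_zero]
    refine Finset.sum_eq_zero fun l _ => ?_
    rw [← List.replicate_succ, List.take_replicate, taylor_replicate]
    rfl

/-- The linear part of the codifferential dominates on words with two letters `t`. -/
lemma map_coder_t_t {G : Module.End k (T k Letter)} {m : ℕ}
    (hG : ∀ v : List Letter, v.length < m + 2 → G (word k v) = 0) :
    G (coder sdeg (taylor k)
      (word k (Letter.t :: Letter.t :: List.replicate m Letter.dt))) =
      G (word k (Letter.t :: Letter.dt :: List.replicate m Letter.dt)) -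
        G (word k (Letter.dt :: Letter.t :: List.replicate m Letter.dt)) := by
  have hs : sgn k (sdeg Letter.t) = -1 := sgn_neg_one
  rw [coder_word_cons, coder_word_cons, coder_replicate, map_zero, smul_zero, add_zero, hs,
    map_add, map_sum, map_smul, map_sum, map_sum, Finset.sum_eq_single 1, Finset.sum_eq_single 1]
  · have h1 : ∀ w : List Letter, taylor k ((Letter.t :: w).take 1) =
        - Finsupp.single Letter.dt 1 := fun w => rfl
    rw [h1, h1, ← Finsupp.single_neg, Finsupp.sum_single_index (by simp),
      Finsupp.sum_single_index (by simp), map_smul, map_smul, map_smul, cons_word (by simp)]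
    simp
    abel
  -- For `l ≥ 2` the operation shortens the word, and `G` vanishes on the result; the other sum is
  -- treated in the same way.
  · intro l hl hne
    rw [map_finsuppSum, map_finsuppSum]
    refine Finset.sum_eq_zero fun j _ => ?_
    simp only [map_smul]
    rw [cons_word (by simp), hG, smul_zero]
    simp at hl ⊢
    omega
  · simp
  · intro l hl hne
    rw [map_finsuppSum]
    refine Finset.sum_eq_zero fun j _ => ?_
    simp only [map_smul]
    rw [hG, smul_zero]
    simp at hl ⊢
    omega
  · simp

lemma isUnitalCInf_ext [CharZero k] {F F' : Module.End k (T k Letter)}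
    (hF : IsUnitalCInf sdeg (taylor k) Letter.one F)
    (hF' : IsUnitalCInf sdeg (taylor k) Letter.one F')
    (h : ∀ j, proj k Letter (F (word k [j])) = proj k Letter (F' (word k [j]))) : F = F' := by
  suffices H : ∀ n, ∀ w : List Letter, w.length < n → F (word k w) = F' (word k w) from
    hom_ext fun w _ => H _ w (Nat.lt_succ_self _)
  intro n
  induction n with
  | zero => exact fun w hw => absurd hw (Nat.not_lt_zero _)
  | succ n ih =>
    -- it suffices to compare the Taylor coefficients
    have step : ∀ w : List Letter, w.length = n → w ≠ [] →
        (∀ j, F (word k w) ⟨[j], by simp⟩ = F' (word k w) ⟨[j], by simp⟩) →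
        F (word k w) = F' (word k w) := by
      intro w hn hw hj
      ext ⟨v, hv⟩
      rcases v with _ | ⟨j, v⟩
      · exact absurd rfl hv
      · by_cases hv' : v = []
        · subst hv'
          exact hj j
        · exact apply_cons_eq_of_comul hF.comul hF'.comul (fun u hu => ih u (by omega)) hw j
            ⟨v, hv'⟩
    intro w hw
    rcases Nat.lt_succ_iff_lt_or_eq.1 hw with hlt | hn
    · exact ih w hlt
    by_cases hw0 : w = []
    · rw [hw0, word_nil, map_zero, map_zero]
    by_cases hw1 : w.length < 2
    · rcases w with _ | ⟨a, _ | ⟨b, w⟩⟩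
      · exact absurd rfl hw0
      · refine step _ hn hw0 fun j => ?_
        rw [← proj_apply, ← proj_apply, h]
      · simp at hw1
    -- With at least two letters `t` the word has degree at most -2, whereas single letters have
    -- degree -1 or 0.
    have hdeg : ∀ w : List Letter, w.length = n → w ≠ [] → 2 ≤ w.length → Letter.one ∉ w →
        2 ≤ w.count Letter.t → F (word k w) = F' (word k w) := by
      intro w hn hw0 hw2 h1 h2
      refine step w hn hw0 fun j => ?_
      have hz : ∀ {E : Module.End k (T k Letter)}, IsUnitalCInf sdeg (taylor k) Letter.one E →
          E (word k w) ⟨[j], by simp⟩ = 0 := by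
        intro E hE
        by_contra hne
        have hd := hE.degree ⟨w, hw0⟩ ⟨[j], by simp⟩ hne
        have h3 := wdeg_eq_of_not_mem h1
        have h4 : wdeg sdeg [j] = sdeg j := by simp [wdeg]
        rw [h4, h3] at hd
        cases j <;> simp [sdeg] at hd <;> omega
      rw [hz hF, hz hF']
    by_cases h1 : Letter.one ∈ w
    · refine step w hn hw0 fun j => ?_
      rw [← proj_apply, ← proj_apply, hF.unit_zero w (by omega) h1,
        hF'.unit_zero w (by omega) h1]
    -- the difference vanishes on shorter words and on shuffles
    set G := F - F' with hG
    have hGs : ∀ v : List Letter, v.length < n → G (word k v) = 0 := fun v hv => by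
      rw [hG, LinearMap.sub_apply, ih v hv, sub_self]
    have hsh : ∀ (u v : List Letter) (j : Letter), u ≠ [] → v ≠ [] →
        G (shuffleWord k sdeg u v) ⟨[j], by simp⟩ = 0 := by
      intro u v j hu hv
      have : shuffleWord k sdeg u v = shuffle k sdeg (word k u) (word k v) := by
        rw [shuffle, lift_word _ hu, lift_word _ hv]
      rw [this, hG, LinearMap.sub_apply, hF.shuffle, hF'.shuffle, Finsupp.sub_apply,
        shuffle_apply_singleton, shuffle_apply_singleton, sub_self]
    refine step w hn hw0 fun j => ?_
    suffices hGw : G (word k w) ⟨[j], by simp⟩ = 0 by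
      rw [hG, LinearMap.sub_apply, Finsupp.sub_apply, sub_eq_zero] at hGw
      exact hGw
    rcases Nat.lt_or_ge (w.count Letter.t) 2 with hc | hc
    · rcases Nat.lt_or_ge (w.count Letter.t) 1 with hc0 | hc1
      -- The word is a power of `dt`, hence up to a nonzero integer factor the shuffle of `dt` with
      -- a shorter power.
      · rw [eq_replicate_of_count h1 (by omega)]
        obtain ⟨p, hp⟩ : ∃ p, w.length = p + 2 := ⟨w.length - 2, by omega⟩
        have h2 := hsh [Letter.dt] (List.replicate (p + 1) Letter.dt) j (by simp) (by simp)
        rw [shuffleWord_dt_replicate, map_smul, Finsupp.smul_apply, smul_eq_mul] at h2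
        rw [hp]
        exact (mul_eq_zero.1 h2).resolve_left (Nat.cast_add_one_ne_zero _)
      · obtain ⟨m, hm⟩ : ∃ m, n = m + 2 := ⟨n - 2, by omega⟩
        subst hm
        -- Shuffling with `dt` links neighbouring positions of `t`, so one value determines all
        -- others.
        have hrec : ∀ i q : ℕ, i + q = m →
            (i + 1 : k) * G (word k (List.replicate (i + 1) Letter.dt ++
              Letter.t :: List.replicate q Letter.dt)) ⟨[j], by simp⟩ +
            (q + 1 : k) * G (word k (List.replicate i Letter.dt ++
              Letter.t :: List.replicate (q + 1) Letter.dt)) ⟨[j], by simp⟩ = 0 := by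
          intro i q _
          have h2 := hsh [Letter.dt]
            (List.replicate i Letter.dt ++ Letter.t :: List.replicate q Letter.dt) j (by simp)
            (by simp)
          rw [shuffleWord_dt_replicate_append] at h2
          simpa using h2
        have h0 : G (word k (Letter.t :: List.replicate (m + 1) Letter.dt)) ⟨[j], by simp⟩ = 0 := by
          have h2 := hrec 0 m (by omega)
          have h3 := map_coder_t_t (m := m) hGs
          have h4 := hdeg (Letter.t :: Letter.t :: List.replicate m Letter.dt) (by simp)
            (by simp) (by simp) (by simp) (by simp)
          rw [hG, LinearMap.sub_apply, hF.coder, hF'.coder, h4, sub_self, ← hG] at h3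
          have h5 := DFunLike.congr_fun h3 (⟨[j], by simp⟩ : {v : List Letter // v ≠ []})
          rw [Finsupp.sub_apply] at h5
          simp only [Nat.cast_zero, zero_add, one_mul, List.replicate_one, List.replicate_zero,
            List.nil_append, List.singleton_append] at h2
          -- The codifferential of `t t dt ⋯ dt` equates the values at the first two positions of
          -- `t`, while the shuffle relation makes the second `-(m + 1)` times the first.
          have h6 : ((m + 2 : ℕ) : k) * G (word k
              (Letter.t :: List.replicate (m + 1) Letter.dt)) ⟨[j], by simp⟩ = 0 := by
            rw [← List.replicate_succ, Finsupp.zero_apply] at h5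
            push_cast
            linear_combination h2 - h5
          exact (mul_eq_zero.1 h6).resolve_left (Nat.cast_ne_zero.2 (Nat.succ_ne_zero _))
        have hall : ∀ i q : ℕ, i + q = m + 1 → G (word k (List.replicate i Letter.dt ++
              Letter.t :: List.replicate q Letter.dt)) ⟨[j], by simp⟩ = 0 := by
          intro i
          induction i with
          | zero =>
            intro q hq
            obtain rfl : q = m + 1 := by omega
            exact h0
          | succ i ihi =>
            intro q hq
            have h2 := hrec i q (by omega)
            rw [ihi (q + 1) (by omega), mul_zero, add_zero] at h2
            exact (mul_eq_zero.1 h2).resolve_left (Nat.cast_add_one_ne_zero _)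
        have hlt : w.idxOf Letter.t < w.length :=
          List.idxOf_lt_length_of_mem (List.count_pos_iff.1 (by omega))
        rw [eq_replicate_append h1 (by omega)]
        exact hall _ _ (by omega)
    · rw [hG, LinearMap.sub_apply, hdeg w hn hw0 (by omega) h1 hc, sub_self]
      rfl

end Whitney

/-! ### Automorphisms of the complex of Whitney forms -/

namespace Whitney

open TBar

variable {k : Type*} [Field k]

lemma basis_apply (j : Letter) : basis k j = letter k j := Module.Basis.mk_apply _ _ _

lemma forms_eq_sum (x : forms k) : x = (basis k).repr x .one • letter k .one +
    ((basis k).repr x .t • letter k .t + (basis k).repr x .dt • letter k .dt) := by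
  conv_lhs => rw [← (basis k).sum_repr x, sum_letter]
  simp only [basis_apply]

lemma forms_fst (x : forms k) :
    (x : PolyForm k).1 = C ((basis k).repr x .one) + C ((basis k).repr x .t) * X := by
  conv_lhs => rw [forms_eq_sum x]
  simp [letter, letterForm, smul_eq_C_mul]

lemma forms_snd (x : forms k) : (x : PolyForm k).2 = C ((basis k).repr x .dt) := by
  conv_lhs => rw [forms_eq_sum x]
  simp [letter, letterForm, smul_eq_C_mul]

lemma mem_forms0 {x : forms k} : x ∈ forms0 k ↔ (basis k).repr x .dt = 0 := by
  have : x ∈ forms0 k ↔ (x : PolyForm k).2 = 0 := Iff.rfl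
  rw [this, forms_snd, C_eq_zero]

lemma mem_forms1 {x : forms k} :
    x ∈ forms1 k ↔ (basis k).repr x .one = 0 ∧ (basis k).repr x .t = 0 := by
  have : x ∈ forms1 k ↔ (x : PolyForm k).1 = 0 := Iff.rfl
  rw [this, forms_fst]
  constructor
  · intro h
    have h0 := congrArg (fun p : k[X] => p.coeff 0) h
    have h1 := congrArg (fun p : k[X] => p.coeff 1) h
    simp at h0 h1
    exact ⟨h0, h1⟩
  · rintro ⟨h0, h1⟩
    simp [h0, h1]

lemma repr_letter (i j : Letter) : (basis k).repr (letter k i) j = if i = j then 1 else 0 := by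
  rw [← basis_apply, Module.Basis.repr_self, Finsupp.single_apply]

lemma d_one : d k (letter k .one) = 0 := by
  apply Subtype.ext
  simp [d, polyD, letter, letterForm]

lemma d_t : d k (letter k .t) = letter k .dt := by
  apply Subtype.ext
  simp [d, polyD, letter, letterForm]

lemma d_dt : d k (letter k .dt) = 0 := by
  apply Subtype.ext
  simp [d, polyD, letter, letterForm]

lemma end_ext {ξ η : Module.End k (forms k)} (h : ∀ j, ξ (letter k j) = η (letter k j)) : ξ = η :=
  (basis k).ext fun j => by rw [basis_apply, h]

variable (k) in
/-- The endomorphism of the complex of Whitney forms with `t ↦ a t + b`. -/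
def affEnd (a b : k) : Module.End k (forms k) :=
  (basis k).constr k fun j => match j with
    | .one => letter k .one
    | .t => a • letter k .t + b • letter k .one
    | .dt => a • letter k .dt

lemma affEnd_one (a b : k) : affEnd k a b (letter k .one) = letter k .one := by
  rw [← basis_apply, affEnd, Module.Basis.constr_basis, basis_apply]

lemma affEnd_t (a b : k) :
    affEnd k a b (letter k .t) = a • letter k .t + b • letter k .one := by
  rw [← basis_apply, affEnd, Module.Basis.constr_basis, basis_apply]

lemma affEnd_dt (a b : k) : affEnd k a b (letter k .dt) = a • letter k .dt := by
  rw [← basis_apply, affEnd, Module.Basis.constr_basis, basis_apply]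

lemma affEnd_apply (a b : k) (x : forms k) : affEnd k a b x =
    (basis k).repr x .one • letter k .one + ((basis k).repr x .t • (a • letter k .t +
      b • letter k .one) + (basis k).repr x .dt • a • letter k .dt) := by
  conv_lhs => rw [forms_eq_sum x]
  simp only [map_add, map_smul, affEnd_one, affEnd_t, affEnd_dt]

lemma affEnd_mem_chainEnd (a b : k) : affEnd k a b ∈ chainEnd k := by
  refine ⟨fun x hx => ?_, fun x hx => ?_, fun x => ?_, affEnd_one a b⟩
  · rw [mem_forms0] at hx ⊢
    rw [affEnd_apply, hx]
    simp [repr_letter]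
  · rw [mem_forms1] at hx ⊢
    rw [affEnd_apply, hx.1, hx.2]
    simp [repr_letter]
  · have : d k ∘ₗ affEnd k a b = affEnd k a b ∘ₗ d k := by
      refine end_ext fun j => ?_
      cases j <;> simp [affEnd_one, affEnd_t, affEnd_dt, d_one, d_t, d_dt]
    exact LinearMap.congr_fun this x

/-- The image of `t` has degree zero, so it is `a t + b`; the image of `dt = d t` is then forced. -/
lemma exists_eq_affEnd {ξ : Module.End k (forms k)} (hξ : ξ ∈ chainEnd k) :
    ∃ a b, ξ = affEnd k a b := by
  obtain ⟨h0, -, hd, h1⟩ := hξ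
  have ht : ξ (letter k .t) ∈ forms0 k := h0 _ (mem_forms0.2 (by simp [repr_letter]))
  rw [mem_forms0] at ht
  have h2 := forms_eq_sum (ξ (letter k .t))
  rw [ht, zero_smul, add_zero] at h2
  refine ⟨(basis k).repr (ξ (letter k .t)) .t, (basis k).repr (ξ (letter k .t)) .one,
    end_ext fun j => ?_⟩
  cases j
  · rw [h1, affEnd_one]
  · rw [affEnd_t, add_comm]
    exact h2
  · rw [affEnd_dt, ← d_t, ← hd, h2]
    simp [d_one, d_t, repr_letter]

lemma chainEnd_ext {ξ η : Module.End k (forms k)} (hξ : ξ ∈ chainEnd k) (hη : η ∈ chainEnd k)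
    (h : ξ (letter k .t) = η (letter k .t)) : ξ = η := by
  refine end_ext fun j => ?_
  cases j
  · rw [hξ.2.2.2, hη.2.2.2]
  · exact h
  · rw [← d_t, ← hξ.2.2.1, ← hη.2.2.1, h]

/-! ### The linear part of a morphism -/

lemma incl_single (j : Letter) (c : k) : incl k Letter (Finsupp.single j c) = c • word k [j] := by
  simp [incl]

lemma incl_apply_singleton (v : Letter →₀ k) (j : Letter) :
    incl k Letter v ⟨[j], by simp⟩ = v j := by
  induction v using Finsupp.induction_linear with
  | zero => simp
  | add x y hx hy => rw [map_add, Finsupp.add_apply, hx, hy, Finsupp.add_apply]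
  | single i c =>
    rw [incl_single, word_eq ⟨[i], by simp⟩]
    simp [Finsupp.single_apply]

lemma incl_apply_cons_cons (v : Letter →₀ k) (i j : Letter) (w : List Letter) :
    incl k Letter v ⟨i :: j :: w, by simp⟩ = 0 := by
  induction v using Finsupp.induction_linear with
  | zero => simp
  | add x y hx hy => rw [map_add, Finsupp.add_apply, hx, hy, add_zero]
  | single l c =>
    rw [incl_single, word_eq ⟨[l], by simp⟩]
    simp

lemma comul_incl (v : Letter →₀ k) : comul k Letter (incl k Letter v) = 0 := by
  have : comul k Letter ∘ₗ incl k Letter = 0 := by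
    refine Finsupp.lhom_ext fun j c => ?_
    rw [LinearMap.comp_apply, incl_single, map_smul, comul, lift_word _ (by simp)]
    simp [word_nil]
  exact LinearMap.congr_fun this v

/-- Tensors of length one have zero coproduct, hence so do their images, and such elements again
have length one. This makes the linear part multiplicative. -/
lemma incl_proj_apply {F : Module.End k (T k Letter)} {m : List Letter → (Letter →₀ k)}
    (hF : IsUnitalCInf sdeg m Letter.one F) (v : Letter →₀ k) :
    incl k Letter (proj k Letter (F (incl k Letter v))) = F (incl k Letter v) := by
  ext ⟨w, hw⟩
  rcases w with _ | ⟨i, _ | ⟨j, w⟩⟩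
  · exact absurd rfl hw
  · rw [incl_apply_singleton, proj_apply]
  · have h := coeff_comul i (⟨j :: w, by simp⟩ : {v : List Letter // v ≠ []}) (F (incl k Letter v))
    rw [hF.comul, comul_incl, map_zero, map_zero, map_zero] at h
    rw [incl_apply_cons_cons]
    exact h

lemma repr_linearPart_letter (F : Module.End k (T k Letter)) (j : Letter) :
    (basis k).repr (linearPart F (letter k j)) = proj k Letter (F (word k [j])) := by
  simp [linearPart, ← basis_apply, incl_single]

lemma linearPart_one : linearPart (1 : Module.End k (T k Letter)) = 1 := by
  refine end_ext fun j => (basis k).repr.injective ?_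
  rw [repr_linearPart_letter, Module.End.one_apply, Module.End.one_apply, ← basis_apply,
    Module.Basis.repr_self]
  exact lift_word _ (by simp)

lemma linearPart_mul (G : Module.End k (T k Letter)) {F : Module.End k (T k Letter)}
    {m : List Letter → (Letter →₀ k)} (hF : IsUnitalCInf sdeg m Letter.one F) :
    linearPart (G * F) = linearPart G * linearPart F := by
  refine LinearMap.ext fun x => ?_
  simp only [linearPart, LinearMap.comp_apply, Module.End.mul_apply, LinearEquiv.coe_coe,
    LinearEquiv.apply_symm_apply, incl_proj_apply hF]

lemma coder_word_singleton (m : List Letter → (Letter →₀ k)) (j : Letter) :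
    coder sdeg m (word k [j]) = incl k Letter (m [j]) := by
  rw [coder_word_cons]
  simp [word_nil, incl, Finsupp.linearCombination_apply]

lemma linearPart_mem_chainEnd {F : Module.End k (T k Letter)}
    (hF : IsUnitalCInf sdeg (taylor k) Letter.one F) : linearPart F ∈ chainEnd k := by
  have hdeg : ∀ i j, sdeg i ≠ sdeg j → proj k Letter (F (word k [i])) j = 0 := by
    intro i j hij
    rw [proj_apply]
    by_contra h
    have := hF.degree ⟨[i], by simp⟩ ⟨[j], by simp⟩ h
    simp [wdeg] at this
    exact hij this.symm
  have hs : ∀ j, F (word k [j]) = incl k Letter (proj k Letter (F (word k [j]))) := by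
    intro j
    have := incl_proj_apply hF (Finsupp.single j 1)
    rw [incl_single, one_smul] at this
    exact this.symm
  have ht : proj k Letter (F (word k [Letter.t])) =
      Finsupp.single .t (proj k Letter (F (word k [Letter.t])) .t) +
        Finsupp.single .one (proj k Letter (F (word k [Letter.t])) .one) := by
    ext j
    cases j
    · simp
    · simp
    · rw [hdeg _ _ (by simp [sdeg])]
      simp
  have hdt : proj k Letter (F (word k [Letter.dt])) =
      Finsupp.single .dt (proj k Letter (F (word k [Letter.t])) .t) := by
    -- Compatibility with the codifferential on the single letter `t` is exactly the chain map
    -- condition, because `m₁ t = -dt`.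
    have h := hF.coder (word k [Letter.t])
    have h1 : taylor k [Letter.t] = - Finsupp.single .dt 1 := rfl
    have h2 : taylor k [Letter.one] = 0 := rfl
    rw [hs .t, ht, map_add, incl_single, incl_single, map_add, map_smul, map_smul,
      coder_word_singleton, coder_word_singleton, h1, h2, map_zero, smul_zero, add_zero, map_neg,
      incl_single, one_smul, map_neg, smul_neg, neg_inj] at h
    rw [h, map_smul]
    have h3 : proj k Letter (word k [Letter.dt]) = Finsupp.single .dt 1 := lift_word _ (by simp)
    rw [h3]
    simp
  have : linearPart F = affEnd k (proj k Letter (F (word k [Letter.t])) .t)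
      (proj k Letter (F (word k [Letter.t])) .one) := by
    refine end_ext fun j => (basis k).repr.injective ?_
    rw [repr_linearPart_letter]
    cases j
    · rw [hF.unit_one, affEnd_one, ← basis_apply, Module.Basis.repr_self]
    · rw [affEnd_t, ht]
      simp only [map_add, map_smul, ← basis_apply, Module.Basis.repr_self]
      simp
    · rw [affEnd_dt, hdt]
      simp only [map_smul, ← basis_apply, Module.Basis.repr_self]
      simp
  rw [this]
  exact affEnd_mem_chainEnd _ _

variable (k) in
/-- Taking the linear part, as a homomorphism of monoids. -/
def linearPartHom : unitalCInfEnd sdeg (taylor k) Letter.one →* chainEnd k where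
  toFun F := ⟨linearPart F.1, linearPart_mem_chainEnd F.2⟩
  map_one' := Subtype.ext linearPart_one
  map_mul' G F := Subtype.ext (linearPart_mul G.1 F.2)

lemma linearPartHom_bijective [CharZero k] : Function.Bijective (linearPartHom k) := by
  constructor
  · intro F F' h
    have h1 : linearPart F.1 = linearPart F'.1 := congrArg Subtype.val h
    refine Subtype.ext (isUnitalCInf_ext F.2 F'.2 fun j => ?_)
    rw [← repr_linearPart_letter, h1, repr_linearPart_letter]
  · rintro ⟨ξ, hξ⟩
    obtain ⟨a, b, rfl⟩ := exists_eq_affEnd hξ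
    -- These times are the values of `a t + b` at the endpoints 0 and 1.
    have hF := affineMorphism_isUnitalCInf b (a + b)
    refine ⟨⟨affineMorphism k b (a + b), hF⟩, Subtype.ext ?_⟩
    refine chainEnd_ext (linearPart_mem_chainEnd hF) hξ ((basis k).repr.injective ?_)
    change (basis k).repr (linearPart (affineMorphism k b (a + b)) (letter k .t)) =
      (basis k).repr (affEnd k a b (letter k .t))
    rw [repr_linearPart_letter, affineMorphism_proj_t, affEnd_t]
    simp only [map_add, map_smul, ← basis_apply, Module.Basis.repr_self]
    simp

variable (k) in
/-- Taking the linear part, as an isomorphism of automorphism groups. -/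
def linearPartEquiv [CharZero k] : AutInf k ≃* ChainAut k :=
  Units.mapEquiv (MulEquiv.ofBijective (linearPartHom k) linearPartHom_bijective)

/-! ### The affine group -/

lemma eval_affEnd (a b x : k) (f : forms k) :
    eval x (affEnd k a b f : PolyForm k).1 = eval (a * x + b) (f : PolyForm k).1 := by
  rw [forms_fst, forms_fst, affEnd_apply]
  simp [repr_letter]
  ring

lemma eval_letter_t (x : k) : eval x (letter k .t : PolyForm k).1 = x := by
  simp [letter, letterForm]

lemma eval_chainEnd {ξ : Module.End k (forms k)} (hξ : ξ ∈ chainEnd k) (x : k) (f : forms k) :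
    eval x (ξ f : PolyForm k).1 =
      eval (eval x (ξ (letter k .t) : PolyForm k).1) (f : PolyForm k).1 := by
  obtain ⟨a, b, rfl⟩ := exists_eq_affEnd hξ
  rw [eval_affEnd, eval_affEnd, eval_letter_t]

/-- The function on points inducing an endomorphism of the Whitney forms by precomposition. -/
def pointMap (ξ : chainEnd k) (x : k) : k := eval x (ξ.1 (letter k .t) : PolyForm k).1

lemma pointMap_one (x : k) : pointMap (1 : chainEnd k) x = x := eval_letter_t x

/-- Precomposition is contravariant; this is why the affine bijection attached to `ξ` is defined
through `ξ⁻¹`. -/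
lemma pointMap_mul (ξ η : chainEnd k) (x : k) :
    pointMap (ξ * η) x = pointMap η (pointMap ξ x) :=
  eval_chainEnd ξ.2 x (η.1 (letter k .t))

lemma exists_pointMap (ξ : chainEnd k) : ∃ a b, ∀ x, pointMap ξ x = a * x + b := by
  obtain ⟨a, b, h⟩ := exists_eq_affEnd ξ.2
  refine ⟨a, b, fun x => ?_⟩
  rw [pointMap, h, eval_affEnd, eval_letter_t]

lemma pointMap_injective : Function.Injective (pointMap (k := k)) := by
  intro ξ η h
  obtain ⟨a, b, hξ⟩ := exists_eq_affEnd ξ.2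
  obtain ⟨a', b', hη⟩ := exists_eq_affEnd η.2
  have h' : ∀ x, a * x + b = a' * x + b' := fun x => by
    have := congrFun h x
    rwa [pointMap, pointMap, hξ, hη, eval_affEnd, eval_affEnd, eval_letter_t, eval_letter_t] at this
  have h0 := h' 0
  have h1 := h' 1
  simp only [mul_zero, zero_add, mul_one] at h0 h1
  rw [h0, add_left_inj] at h1
  exact Subtype.ext (by rw [hξ, hη, h0, h1])

/-- The affine bijection `A` with `ξ f = f ∘ A⁻¹`. -/
def pointAffine (ξ : ChainAut k) : k ≃ᵃ[k] k :=
  AffineEquiv.ofBijective (φ := AffineMap.mk (pointMap ((ξ⁻¹ : ChainAut k) : chainEnd k))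
      ((pointMap ((ξ⁻¹ : ChainAut k) : chainEnd k) 1 -
        pointMap ((ξ⁻¹ : ChainAut k) : chainEnd k) 0 : k) • LinearMap.id) (by
    intro p v
    obtain ⟨a, b, h⟩ := exists_pointMap ((ξ⁻¹ : ChainAut k) : chainEnd k)
    simp only [h, vadd_eq_add, LinearMap.smul_apply, LinearMap.id_apply, smul_eq_mul]
    ring)) (by
    refine Function.bijective_iff_has_inverse.2 ⟨pointMap (ξ : chainEnd k), fun x => ?_, fun x => ?_⟩
    · change pointMap _ (pointMap _ x) = x
      rw [← pointMap_mul, Units.inv_mul, pointMap_one]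
    · change pointMap _ (pointMap _ x) = x
      rw [← pointMap_mul, Units.mul_inv, pointMap_one])

lemma pointAffine_apply (ξ : ChainAut k) (x : k) :
    pointAffine ξ x = pointMap ((ξ⁻¹ : ChainAut k) : chainEnd k) x := rfl

lemma affineEquiv_apply (A : k ≃ᵃ[k] k) (x : k) : A x = (A 1 - A 0) * x + A 0 := by
  have h : ∀ y : k, A y = y * A.linear 1 + A 0 := fun y => by
    have := A.map_vadd 0 y
    rw [vadd_eq_add, vadd_eq_add, add_zero] at this
    rw [this, ← smul_eq_mul, ← map_smul, smul_eq_mul, mul_one]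
  rw [h x, h 1]
  ring

/-- The endomorphism of the Whitney forms given by precomposition with an affine bijection. -/
def affineChain (A : k ≃ᵃ[k] k) : chainEnd k :=
  ⟨affEnd k (A 1 - A 0) (A 0), affEnd_mem_chainEnd _ _⟩

lemma pointMap_affineChain (A : k ≃ᵃ[k] k) (x : k) : pointMap (affineChain A) x = A x := by
  rw [affineEquiv_apply A x, pointMap, affineChain, eval_affEnd, eval_letter_t]

lemma affineChain_mul_symm (A : k ≃ᵃ[k] k) : affineChain A * affineChain A.symm = 1 :=
  pointMap_injective <| funext fun x => by
    rw [pointMap_mul, pointMap_affineChain, pointMap_affineChain, AffineEquiv.symm_apply_apply,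
      pointMap_one]

variable (k) in
/-- The group of automorphisms of the complex of Whitney forms is the affine group. -/
def chainAutEquiv : ChainAut k ≃* (k ≃ᵃ[k] k) :=
  MulEquiv.ofBijective
    (MonoidHom.mk' pointAffine fun ξ η => AffineEquiv.ext fun x => by
      rw [AffineEquiv.mul_def, AffineEquiv.trans_apply, pointAffine_apply, pointAffine_apply,
        pointAffine_apply, mul_inv_rev, Units.val_mul, pointMap_mul])
    (by
      constructor
      · intro ξ η h
        refine inv_injective (Units.ext (pointMap_injective (funext fun x => ?_)))
        exact DFunLike.congr_fun h x
      · intro A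
        -- The preimage of `A` is precomposition with its inverse.
        refine ⟨⟨affineChain A.symm, affineChain A, affineChain_mul_symm A.symm,
          affineChain_mul_symm A⟩, AffineEquiv.ext fun x => ?_⟩
        exact pointMap_affineChain A x)

lemma eval_chainAutEquiv (ξ : ChainAut k) (f : forms k) (x : k) :
    eval (chainAutEquiv k ξ x) ((ξ : chainEnd k).1 f : PolyForm k).1 =
      eval x (f : PolyForm k).1 := by
  rw [eval_chainEnd (ξ : chainEnd k).2]
  change eval (pointMap _ (pointMap _ x)) _ = _
  rw [← pointMap_mul, Units.inv_mul, pointMap_one]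

lemma affineEquiv_slope_ne_zero (A : k ≃ᵃ[k] k) : A 1 - A 0 ≠ 0 := fun h =>
  one_ne_zero (A.injective (sub_eq_zero.1 h))

variable (k) in
/-- The affine group is the semidirect product of scalings and translations. -/
def affineEquivSemidirect : (k ≃ᵃ[k] k) ≃* Multiplicative k ⋊[scaling k] kˣ :=
  MulEquiv.ofBijective
    (MonoidHom.mk' (fun A => (⟨Multiplicative.ofAdd (A 0),
        Units.mk0 (A 1 - A 0) (affineEquiv_slope_ne_zero A)⟩ :
          Multiplicative k ⋊[scaling k] kˣ)) fun A B => by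
      have h : ∀ x, (A * B) x = A (B x) := fun _ => rfl
      refine SemidirectProduct.ext ?_ (Units.ext ?_)
      · apply Multiplicative.toAdd.injective
        change (A * B) 0 = A 0 + (A 1 - A 0) * B 0
        rw [h, affineEquiv_apply A (B 0), add_comm]
      · change (A * B) 1 - (A * B) 0 = (A 1 - A 0) * (B 1 - B 0)
        rw [h, h, affineEquiv_apply A (B 0), affineEquiv_apply A (B 1)]
        ring)
    (by
      constructor
      · intro A B h
        have h0 : A 0 = B 0 := congrArg (fun p => Multiplicative.toAdd p.left) h
        have h1 : A 1 - A 0 = B 1 - B 0 := congrArg (fun p => (p.right : k)) h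
        refine AffineEquiv.ext fun x => ?_
        rw [affineEquiv_apply A, affineEquiv_apply B, h1, h0]
      · rintro ⟨β, α⟩
        refine ⟨(DistribMulAction.toLinearEquiv k k α).toAffineEquiv.trans
          (AffineEquiv.constVAdd k k (Multiplicative.toAdd β)), ?_⟩
        refine SemidirectProduct.ext ?_ (Units.ext ?_)
        · apply Multiplicative.toAdd.injective
          change Multiplicative.toAdd β + α • (0 : k) = Multiplicative.toAdd β
          rw [smul_zero, add_zero]
        · change (Multiplicative.toAdd β + α • (1 : k)) - (Multiplicative.toAdd β + α • (0 : k)) = α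
          rw [Units.smul_def, Units.smul_def]
          simp)

lemma affineEquivSemidirect_apply (A : k ≃ᵃ[k] k) (x : k) :
    A x = ((affineEquivSemidirect k A).right : k) * x +
      Multiplicative.toAdd (affineEquivSemidirect k A).left :=
  affineEquiv_apply A x

end Whitney

end

/-- Taking the linear part is an isomorphism from the group of unital `C∞` automorphisms of the
Whitney forms onto the group of automorphisms of the complex of Whitney forms that fix `1`, which
is the affine group of `k` (by `f ↦ f ∘ A⁻¹` on degree zero forms), which in turn is `kˣ ⋉ k`. -/
theorem mainTheorem8 (k : Type*) [Field k] [CharZero k] :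
    (∃ r : Whitney.AutInf k ≃* Whitney.ChainAut k,
      ∀ ψ : Whitney.AutInf k,
        (((r ψ : Whitney.chainEnd k)) : Module.End k (Whitney.forms k)) =
          Whitney.linearPart
            ((ψ : TBar.unitalCInfEnd Whitney.sdeg (Whitney.taylor k) Whitney.Letter.one) :
              Module.End k (TBar.T k Whitney.Letter))) ∧
    (∃ e : Whitney.ChainAut k ≃* (k ≃ᵃ[k] k),
      ∀ (ξ : Whitney.ChainAut k) (f : Whitney.forms k) (x : k),
        Polynomial.eval (e ξ x)
            ((((ξ : Whitney.chainEnd k) : Module.End k (Whitney.forms k)) f : Whitney.forms k) :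
              Whitney.PolyForm k).1 =
          Polynomial.eval x (f : Whitney.PolyForm k).1) ∧
    (∃ e' : (k ≃ᵃ[k] k) ≃* Multiplicative k ⋊[Whitney.scaling k] kˣ,
      ∀ (A : k ≃ᵃ[k] k) (x : k),
        A x = ((e' A).right : k) * x + Multiplicative.toAdd (e' A).left) := by
  exact ⟨⟨Whitney.linearPartEquiv k, fun _ => rfl⟩,
    ⟨Whitney.chainAutEquiv k, Whitney.eval_chainAutEquiv⟩,
    ⟨Whitney.affineEquivSemidirect k, Whitney.affineEquivSemidirect_apply⟩⟩
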